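/- **Setting.** $M\ge 2$ machines have objectives $F_m:\mathbb R^d\to\mathbb R$, and $F=\frac1M\sum_m F_m$. For $H>0$, $\Delta,\zeta\ge 0$ and $0\le\tau\le 2H$, let $\mathcal P(H,\Delta,\tau,\zeta)$ be the class of all such problems (of any dimension $d$) with twice differentiable $F_m$ such that for all $m,n$ and $x,y$: $\|\nabla F_m(x)-\nabla F_m(y)\|\le H\|x-y\|$; $F(0)-\inf F\le\Delta$; $\|\nabla^2F_m(x)-\nabla^2F_n(x)\|\le\tau$; $\|\nabla F_m(x)-\nabla F_n(x)\|\le H\zeta$. A stochastic two-point oracle with variance $\sigma^2$ on machine $m$, queried at a pair $(x_1,x_2)$, draws a fresh $z\sim\mathcal D_m$ and returns $(s_z(x_i),g_z(x_i))_{i=1,2}$, where $\mathbb E\,s_z(x)=F_m(x)$, $\mathbb E\,g_z(x)=\nabla F_m(x)$, $\mathbb E\|g_z(x)-\nabla F_m(x)\|^2\le\sigma^2$ and $\mathbb E\|g_z(x)-g_z(y)\|\le H\|x-y\|$ for all $x,y$. A distributed zero-respecting algorithm with $R$ communication rounds and $K$ oracle calls per machine per round chooses each query as a deterministic measurable function of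 all answers of all machines in earlier rounds and of the machine's own earlier answers in the current round; the query points are supported on the union of the supports of the gradient vectors in those answers. Its output $x_R$ is a deterministic measurable function of all answers, supported on the union of the supports of all gradient vectors received. **Theorem.** (i) There is a universal constant $c>0$ such that for all $M\ge2$, $K\ge1$, $R\ge1$, $H>0$, $\Delta,\zeta,\sigma\ge0$ and $0\le\tau\le2H$ with $\frac{\sigma^2}{MKR}\le\Delta H$ there are a problem in $\mathcal P(H,\Delta,\tau,\zeta)$ and two-point oracles for it with variance $\sigma^2$ such that the output $x_R$ of every distributed zero-respecting algorithm satisfies $$\mathbb E\|\nabla F(x_R)\|^2\ \ge\ c\left(\min\Big\{\frac{H^2\zeta^2}{R},\frac{\Delta\tau}{R}\Big\}+\frac{\Delta H}{KR}+\frac{\sigma^2}{MKR}+\Big(\frac{\sigma\Delta H}{MKR}\Big)^{2/3}\right).$$ (ii) Consequently CE-LSGD is minimax optimal in the deterministic case when $\Delta\tau\le H^2\zeta^2$. Here CE-LSGD with exact gradients, step size $\eta$ and $N$ iterations starts at $x_0=0$; in iteration $r=0,\dots,N-1$ it computes $v_r=\frac1M\sum_m\nabla F_m(x_r)$, samples a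 uniformly random machine $m$ (independently of the past), sets $w_{r+1,0}=w_{r+1,1}=x_r$, $v_{r,0}=v_r$ and, for $k=1,\dots,Q_r$ with $Q_0=1$ and $Q_r=K$ for $r\ge1$, $$v_{r,k}=v_{r,k-1}+\nabla F_m(w_{r+1,k})-\nabla F_m(w_{r+1,k-1}),\qquad w_{r+1,k+1}=w_{r+1,k}-\eta v_{r,k},$$ and then sets $x_{r+1}=w_{r+1,Q_r+1}$; its output $\tilde x$ is uniform among all $w_{r+1,k}$ with $0\le r<N$, $1\le k\le Q_r$. Each iteration uses two communication rounds. There are universal constants $a,C>0$ such that for all $M\ge2$, $K\ge1$, $N\ge2$, $H>0$, $\Delta,\zeta\ge0$ and $0\le\tau\le2H$ with $\Delta\tau\le H^2\zeta^2$, CE-LSGD with $\eta=a\min\{\frac1H,\frac1{K\tau}\}$ satisfies, on every problem in $\mathcal P(H,\Delta,\tau,\zeta)$, $$\mathbb E\|\nabla F(\tilde x)\|^2\ \le\ C\cdot\inf_A\sup_P\ \mathbb E\|\nabla F(x^A_{2N})\|^2,$$ where $A$ ranges over the distributed zero-respecting algorithms with $2N$ communication rounds and $K$ oracle calls per machine per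 round, and $P$ over the problems in $\mathcal P(H,\Delta,\tau,\zeta)$ with two-point oracles of variance $0$. -/

import Mathlib

open MeasureTheory
open scoped ENNReal

noncomputable section

namespace DistOpt

/-- `ℝ^d` with the Euclidean norm. -/
abbrev Vec (d : ℕ) : Type := EuclideanSpace ℝ (Fin d)

/-- The set of nonzero coordinates of a vector. -/
def supp {d : ℕ} (v : Vec d) : Set (Fin d) := {i | v i ≠ 0}

/-- The average objective `F = (1/M) ∑ₘ Fₘ`. -/
def avg {M d : ℕ} (F : Fin M → Vec d → ℝ) (x : Vec d) : ℝ := (∑ m, F m x) / (M : ℝ)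

/-- The problem class: machine objectives that are twice differentiable and `H`-smooth, whose average
has initial suboptimality `F(0) - inf F ≤ Δ`, with second-order heterogeneity `τ` and uniform
first-order heterogeneity `H ζ`. -/
structure InClass {M d : ℕ} (F : Fin M → Vec d → ℝ) (H Δ τ ζ : ℝ) : Prop where
  differentiable : ∀ m, Differentiable ℝ (F m)
  twice_differentiable : ∀ m, Differentiable ℝ (gradient (F m))
  smooth : ∀ m x y, ‖gradient (F m) x - gradient (F m) y‖ ≤ H * ‖x - y‖
  subopt : ∀ x, avg F 0 - avg F x ≤ Δ
  second_order : ∀ m n x,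
    ‖fderiv ℝ (gradient (F m)) x - fderiv ℝ (gradient (F n)) x‖ ≤ τ
  first_order : ∀ m n x, ‖gradient (F m) x - gradient (F n) x‖ ≤ H * ζ

/-- What a two-point query is: two points of `ℝ^d`. -/
abbrev Query (d : ℕ) : Type := Fin 2 → Vec d

/-- What a two-point oracle answers: two function values and two gradient vectors. -/
abbrev Answer (d : ℕ) : Type := (Fin 2 → ℝ) × (Fin 2 → Vec d)

/-- The coordinates revealed by an answer, i.e. those in the support of a returned gradient. -/
def answerSupp {d : ℕ} (a : Answer d) : Set (Fin d) := ⋃ j, supp (a.2 j)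

/-- The data of stochastic first-order oracles on `M` machines: machine `m` draws `z ∼ D m`, and
a datum `z` yields the function values `s z x` and gradient estimates `g z x`. -/
structure Oracle (M d : ℕ) where
  Z : Type
  [measurableSpace : MeasurableSpace Z]
  D : Fin M → Measure Z
  [prob : ∀ m, IsProbabilityMeasure (D m)]
  s : Z → Vec d → ℝ
  g : Z → Vec d → Vec d

attribute [instance] Oracle.measurableSpace Oracle.prob

/-- The answer to a two-point query: the same datum is used at both points. -/
def Oracle.answer {M d : ℕ} (O : Oracle M d) (z : O.Z) (q : Query d) : Answer d :=
  (fun j => O.s z (q j), fun j => O.g z (q j))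

/-- The oracles are unbiased for `F`, have variance at most `σ²`, and are `H`-mean smooth. -/
structure Oracle.IsFor {M d : ℕ} (O : Oracle M d) (F : Fin M → Vec d → ℝ) (H σ : ℝ) : Prop where
  measurable_s : Measurable (fun p : O.Z × Vec d => O.s p.1 p.2)
  measurable_g : Measurable (fun p : O.Z × Vec d => O.g p.1 p.2)
  integrable_s : ∀ m x, Integrable (fun z => O.s z x) (O.D m)
  integrable_g : ∀ m x, Integrable (fun z => O.g z x) (O.D m)
  mean_s : ∀ m x, ∫ z, O.s z x ∂(O.D m) = F m x
  mean_g : ∀ m x, ∫ z, O.g z x ∂(O.D m) = gradient (F m) x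
  variance : ∀ m x, ∫⁻ z, ‖O.g z x - gradient (F m) x‖ₑ ^ 2 ∂(O.D m) ≤ ENNReal.ofReal (σ ^ 2)
  mean_smooth : ∀ m x y, ∫⁻ z, ‖O.g z x - O.g z y‖ₑ ∂(O.D m) ≤ ENNReal.ofReal (H * ‖x - y‖)

/-- A distributed zero-respecting algorithm initialized at `0`, with `M` machines, `R` rounds and `K`
two-point oracle calls per machine and round. The query of machine `m` at call `k` of round `r` is
a (measurable) function of all answers of all machines in the earlier rounds and of its own earlier
answers in the current round, and is supported on the coordinates which those answers revealed.
After round `R` the output is a function of all answers, supported on the revealed coordinates. -/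
structure ZRAlgorithm (M K R d : ℕ) where
  query : (r : Fin R) → (k : Fin K) → (m : Fin M) →
    (Fin r.val → Fin K → Fin M → Answer d) → (Fin k.val → Answer d) → Query d
  measurable_query : ∀ r k m, Measurable
    (fun h : (Fin r.val → Fin K → Fin M → Answer d) × (Fin k.val → Answer d) =>
      query r k m h.1 h.2)
  supp_query : ∀ r k m past loc j, supp (query r k m past loc j) ⊆
    (⋃ l, answerSupp (loc l)) ∪ (⋃ s, ⋃ l, ⋃ n, answerSupp (past s l n))
  output : (Fin R → Fin K → Fin M → Answer d) → Vec d
  measurable_output : Measurable output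
  supp_output : ∀ all, supp (output all) ⊆ ⋃ s, ⋃ l, ⋃ n, answerSupp (all s l n)

/-- The answers received during the run of the algorithm, when `z (r, k, m)` is the datum drawn by
machine `m` at call `k` of round `r`. -/
def transcript {M K R d : ℕ} (A : ZRAlgorithm M K R d) (O : Oracle M d)
    (z : Fin R × Fin K × Fin M → O.Z) (r : Fin R) (k : Fin K) (m : Fin M) : Answer d :=
  O.answer (z (r, k, m))
    (A.query r k m
      (fun r' k' m' => transcript A O z ⟨r'.val, r'.isLt.trans r.isLt⟩ k' m')
      (fun k' => transcript A O z r ⟨k'.val, k'.isLt.trans k.isLt⟩ m))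
termination_by (r.val, k.val)
decreasing_by
  · exact Prod.Lex.left _ _ r'.isLt
  · exact Prod.Lex.right _ k'.isLt

/-- `𝔼 ‖∇F(x_R)‖²` for the output `x_R` of the algorithm; all data are drawn independently. -/
def expectedError {M K R d : ℕ} (A : ZRAlgorithm M K R d) (F : Fin M → Vec d → ℝ)
    (O : Oracle M d) : ℝ≥0∞ :=
  ∫⁻ z, ‖gradient (avg F) (A.output (transcript A O z))‖ₑ ^ 2
    ∂(Measure.pi fun i : Fin R × Fin K × Fin M => O.D i.2.2)

/-- The min-max error of zero-respecting algorithms over the problem class. The class contains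
problems of every dimension, so an algorithm is given for every dimension. -/
def minimaxError (M K R : ℕ) (H Δ τ ζ σ : ℝ) : ℝ≥0∞ :=
  ⨅ A : (d : ℕ) → ZRAlgorithm M K R d,
    ⨆ (d : ℕ) (F : Fin M → Vec d → ℝ) (O : Oracle M d)
      (_ : InClass F H Δ τ ζ) (_ : O.IsFor F H σ), expectedError (A d) F O

/-! ### CE-LSGD with exact gradients and momentum parameter `β = 1` -/

/-- Local phase on the client with gradient map `G`, started at `x` with the estimate `v`. The value
at `k` is `(w_k, w_{k+1}, v_k)`, where `w_0 = w_1 = x`, `v_0 = v`,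
`v_k = v_{k-1} + G w_k - G w_{k-1}` and `w_{k+1} = w_k - η v_k`. -/
def localPhase {d : ℕ} (η : ℝ) (G : Vec d → Vec d) (x v : Vec d) : ℕ → Vec d × Vec d × Vec d
  | 0 => (x, x, v)
  | k + 1 =>
    let st := localPhase η G x v k
    let v' := st.2.2 + G st.2.1 - G st.1
    (st.2.1, st.2.1 - η • v', v')

/-- The number `Q` of local steps in iteration `r`: one if `r = 0`, otherwise `K`. -/
def localSteps (K r : ℕ) : ℕ := if r = 0 then 1 else K

/-- The local iterate `w_k` of an iteration started at `x`, run on client `m`; the starting estimate is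
the average over all machines of the exact gradients at `x`. -/
def localIterate {M d : ℕ} (η : ℝ) (F : Fin M → Vec d → ℝ) (m : Fin M) (x : Vec d) (k : ℕ) :
    Vec d :=
  (localPhase η (gradient (F m)) x ((M : ℝ)⁻¹ • ∑ n, gradient (F n) x) k).1

/-- The server iterate `x_r` if `client r` is the client sampled in iteration `r`; `x_0 = 0` and
`x_{r+1} = w_{Q+1}`. -/
def serverIterate {M d : ℕ} (η : ℝ) (K : ℕ) (F : Fin M → Vec d → ℝ) (client : ℕ → Fin M) :
    ℕ → Vec d
  | 0 => 0
  | r + 1 => localIterate η F (client r) (serverIterate η K F client r) (localSteps K r + 1)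

/-- `𝔼 ‖∇F(x̃)‖²` for `N ≥ 1` iterations of CE-LSGD: the clients are sampled independently and
uniformly, and the output `x̃` is uniform among the local iterates `w_1, …, w_Q` of all iterations. -/
def celsgdError {M d : ℕ} (η : ℝ) (K N : ℕ) (F : Fin M → Vec d → ℝ) : ℝ :=
  (∑ client : Fin N → Fin M, (∑ r : Fin N, ∑ k ∈ Finset.Icc 1 (localSteps K r),
      ‖gradient (avg F) (localIterate η F (client r)
        (serverIterate η K F (fun i => client ⟨i % N, Nat.mod_lt i r.pos⟩) r) k)‖ ^ 2)
      / (∑ r : Fin N, (localSteps K r : ℝ)))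
    / (M : ℝ) ^ N

end DistOpt

end

/-!
Upper bound. During a local phase the estimate `v_k` differs from `∇F(w_k)` by an error which each
step changes by at most `τ ‖w_{k+1} - w_k‖ = τ η ‖v_k‖`. As `η K τ ≤ 1/2`, the squared errors of a
phase sum to at most a quarter of `∑ ‖v_k‖²`, and this is absorbed by the descent that the
`H`-smoothness of `F` guarantees. So `F` falls by at least `η/2 ∑ ‖∇F(w_k)‖²` per phase, and in
total by at most `Δ`.

Lower bound. The hard functions are sums of links between consecutive coordinates (Carmon, Duchi,
Hinder and Sidford): wherever the last coordinate vanishes the gradient is bounded below, and at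
points supported on the first `c` coordinates it is supported on the first `c + 1`. A
zero-respecting algorithm thus has to discover the coordinates one after the other, and a chain
longer than its number of discoveries leaves it with a large gradient. Each term of the bound has
its own way of limiting the discoveries.

* `Δ H / (K R)`: every machine holds the whole chain, so each call discloses one coordinate at most.
* The heterogeneous term: even links sit on the even machines and odd links on the odd ones, so each
  communication round discloses one coordinate at most.
* The stochastic terms: the oracle hides the next coordinate unless a Bernoulli variable succeeds,
  so with probability at least `1/2` there are few disclosures.
-/

namespace DistOpt

/-! ### Descent with a drifting gradient estimate -/

section Descent

variable {E : Type*} [NormedAddCommGroup E] [InnerProductSpace ℝ E]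

theorem hasDerivAt_comp_add_smul [CompleteSpace E] {f : E → ℝ} {g : E → E}
    (hf : ∀ x, HasGradientAt f (g x) x) (x v : E) (t : ℝ) :
    HasDerivAt (fun t : ℝ => f (x + t • v)) (inner ℝ (g (x + t • v)) v) t := by
  have hline : HasDerivAt (fun t : ℝ => x + t • v) v t := by
    simpa using ((hasDerivAt_id t).smul_const v).const_add x
  exact ((hf (x + t • v)).hasFDerivAt.comp_hasDerivAt t hline).congr_deriv (by simp)

theorem le_add_inner_add_sq_of_lipschitz_gradient [CompleteSpace E] {f : E → ℝ} {g : E → E} {H : ℝ}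
    (hf : ∀ x, HasGradientAt f (g x) x) (hg : ∀ x y, ‖g x - g y‖ ≤ H * ‖x - y‖) (x y : E) :
    f y ≤ f x + inner ℝ (g x) (y - x) + H / 2 * ‖y - x‖ ^ 2 := by
  obtain ⟨v, rfl⟩ : ∃ v, y = x + v := ⟨y - x, by abel⟩
  have hderiv (t : ℝ) : HasDerivAt
      (fun t : ℝ => f (x + t • v) - t * inner ℝ (g x) v - H / 2 * ‖v‖ ^ 2 * t ^ 2)
      (inner ℝ (g (x + t • v)) v - inner ℝ (g x) v - H * ‖v‖ ^ 2 * t) t := by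
    refine (((hasDerivAt_comp_add_smul hf x v t).sub ((hasDerivAt_id t).mul_const _)).sub
      (((hasDerivAt_id t).pow 2).const_mul (H / 2 * ‖v‖ ^ 2))).congr_deriv ?_
    simp only [id, one_mul, mul_one, Nat.cast_ofNat, Nat.add_one_sub_one, pow_one]
    ring
  have hderiv_nonpos (t : ℝ) (ht : 0 < t) :
      inner ℝ (g (x + t • v)) v - inner ℝ (g x) v - H * ‖v‖ ^ 2 * t ≤ 0 := by
    have hle : inner ℝ (g (x + t • v) - g x) v ≤ H * (t * ‖v‖) * ‖v‖ :=
      calc inner ℝ (g (x + t • v) - g x) v ≤ ‖g (x + t • v) - g x‖ * ‖v‖ := real_inner_le_norm _ _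
        _ ≤ H * ‖x + t • v - x‖ * ‖v‖ := by gcongr; exact hg _ _
        _ = H * (t * ‖v‖) * ‖v‖ := by
          rw [add_sub_cancel_left, norm_smul, Real.norm_of_nonneg ht.le]
    rw [inner_sub_left] at hle
    linarith
  have hanti := antitoneOn_of_deriv_nonpos (convex_Icc (0 : ℝ) 1)
    (fun t _ => (hderiv t).continuousAt.continuousWithinAt)
    (fun t _ => (hderiv t).differentiableAt.differentiableWithinAt) (by
      intro t ht
      rw [interior_Icc] at ht
      exact (hderiv t).deriv ▸ hderiv_nonpos t ht.1)
  have hend := hanti (Set.left_mem_Icc.2 zero_le_one) (Set.right_mem_Icc.2 zero_le_one) zero_le_one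
  simp only [one_smul, zero_smul, add_zero, one_mul, zero_mul, one_pow, mul_one, sub_zero, mul_zero,
    ne_eq, OfNat.ofNat_ne_zero, not_false_eq_true, zero_pow] at hend
  rw [add_sub_cancel_left]
  linarith

theorem inexact_gradient_step_le {f : E → ℝ} {x p : E} {H η : ℝ} (hη : 0 ≤ η) (hHη : H * η ≤ 1 / 2)
    (hf : ∀ y, f y ≤ f x + inner ℝ p (y - x) + H / 2 * ‖y - x‖ ^ 2) (v : E) :
    f (x - η • v) ≤
      f x - η / 2 * ‖p‖ ^ 2 - η / 4 * ‖v‖ ^ 2 + η / 2 * ‖v - p‖ ^ 2 := by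
  have hstep := hf (x - η • v)
  rw [sub_sub_cancel_left, norm_neg, norm_smul, Real.norm_of_nonneg hη, inner_neg_right,
    inner_smul_right] at hstep
  have hcurv : H / 2 * (η * ‖v‖) ^ 2 ≤ η / 4 * ‖v‖ ^ 2 := by
    have := mul_le_mul_of_nonneg_right hHη (mul_nonneg hη (sq_nonneg ‖v‖))
    linarith
  have hpolar : ‖v - p‖ ^ 2 = ‖v‖ ^ 2 - 2 * inner ℝ p v + ‖p‖ ^ 2 := by
    rw [norm_sub_sq_real, real_inner_comm]
  rw [hpolar]
  linarith

section Drift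

variable {g : E → E} {w v : ℕ → E} {η τ : ℝ}

theorem norm_drift_le (hη : 0 ≤ η) (hw1 : w 1 = w 0) (hv0 : v 0 = g (w 0))
    (hw : ∀ k, w (k + 2) = w (k + 1) - η • v (k + 1))
    (hdrift : ∀ k, ‖(v (k + 1) - g (w (k + 1))) - (v k - g (w k))‖ ≤ τ * ‖w (k + 1) - w k‖)
    (k : ℕ) :
    ‖v (k + 1) - g (w (k + 1))‖ ≤ τ * η * ∑ j ∈ Finset.range k, ‖v (j + 1)‖ := by
  induction k with
  | zero => simpa [hw1, hv0] using hdrift 0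
  | succ k ih =>
    have hmove : ‖w (k + 2) - w (k + 1)‖ = η * ‖v (k + 1)‖ := by
      rw [hw k, sub_sub_cancel_left, norm_neg, norm_smul, Real.norm_of_nonneg hη]
    have hnext := hdrift (k + 1)
    rw [hmove] at hnext
    rw [Finset.sum_range_succ, mul_add]
    linarith [norm_le_norm_add_norm_sub' (v (k + 2) - g (w (k + 2))) (v (k + 1) - g (w (k + 1)))]

theorem sum_sq_norm_drift_le (hη : 0 ≤ η) (hτ : 0 ≤ τ) (hw1 : w 1 = w 0) (hv0 : v 0 = g (w 0))
    (hw : ∀ k, w (k + 2) = w (k + 1) - η • v (k + 1))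
    (hdrift : ∀ k, ‖(v (k + 1) - g (w (k + 1))) - (v k - g (w k))‖ ≤ τ * ‖w (k + 1) - w k‖)
    (Q : ℕ) :
    ∑ k ∈ Finset.range Q, ‖v (k + 1) - g (w (k + 1))‖ ^ 2
      ≤ (τ * η * Q) ^ 2 * ∑ k ∈ Finset.range Q, ‖v (k + 1)‖ ^ 2 := by
  have hterm (k : ℕ) (hk : k ∈ Finset.range Q) : ‖v (k + 1) - g (w (k + 1))‖ ^ 2
      ≤ (τ * η) ^ 2 * (Q * ∑ j ∈ Finset.range Q, ‖v (j + 1)‖ ^ 2) :=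
    calc ‖v (k + 1) - g (w (k + 1))‖ ^ 2
        ≤ (τ * η * ∑ j ∈ Finset.range k, ‖v (j + 1)‖) ^ 2 := by
          gcongr; exact norm_drift_le hη hw1 hv0 hw hdrift k
      _ ≤ (τ * η * ∑ j ∈ Finset.range Q, ‖v (j + 1)‖) ^ 2 := by
          gcongr; exact (Finset.mem_range.1 hk).le
      _ ≤ (τ * η) ^ 2 * (Q * ∑ j ∈ Finset.range Q, ‖v (j + 1)‖ ^ 2) := by
          rw [mul_pow]
          gcongr
          simpa using sq_sum_le_card_mul_sum_sq (s := Finset.range Q) (f := fun j => ‖v (j + 1)‖)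
  refine (Finset.sum_le_sum hterm).trans (le_of_eq ?_)
  rw [Finset.sum_const, Finset.card_range, nsmul_eq_mul]
  ring

theorem sum_sq_norm_gradient_le_of_drift {f : E → ℝ} {H : ℝ} {Q : ℕ}
    (hη : 0 ≤ η) (hτ : 0 ≤ τ) (hHη : H * η ≤ 1 / 2) (hτη : τ * η * Q ≤ 1 / 2)
    (hf : ∀ x y, f y ≤ f x + inner ℝ (g x) (y - x) + H / 2 * ‖y - x‖ ^ 2)
    (hw1 : w 1 = w 0) (hv0 : v 0 = g (w 0)) (hw : ∀ k, w (k + 2) = w (k + 1) - η • v (k + 1))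
    (hdrift : ∀ k, ‖(v (k + 1) - g (w (k + 1))) - (v k - g (w k))‖ ≤ τ * ‖w (k + 1) - w k‖) :
    η / 2 * ∑ k ∈ Finset.range Q, ‖g (w (k + 1))‖ ^ 2 ≤ f (w 1) - f (w (Q + 1)) := by
  set V := ∑ k ∈ Finset.range Q, ‖v (k + 1)‖ ^ 2
  have hV : 0 ≤ V := Finset.sum_nonneg fun _ _ => sq_nonneg _
  have herr : ∑ k ∈ Finset.range Q, ‖v (k + 1) - g (w (k + 1))‖ ^ 2 ≤ (1 / 2) ^ 2 * V :=
    (sum_sq_norm_drift_le hη hτ hw1 hv0 hw hdrift Q).trans (by gcongr)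
  have hstep (k : ℕ) : η / 2 * ‖g (w (k + 1))‖ ^ 2 + η / 4 * ‖v (k + 1)‖ ^ 2
      - η / 2 * ‖v (k + 1) - g (w (k + 1))‖ ^ 2 ≤ f (w (k + 1)) - f (w (k + 1 + 1)) := by
    have := inexact_gradient_step_le hη hHη (hf (w (k + 1))) (v (k + 1))
    rw [← hw k] at this
    linarith
  have hsum := Finset.sum_le_sum (s := Finset.range Q) fun k _ => hstep k
  rw [Finset.sum_range_sub' (fun k => f (w (k + 1))), Finset.sum_sub_distrib,
    Finset.sum_add_distrib, ← Finset.mul_sum, ← Finset.mul_sum, ← Finset.mul_sum] at hsum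
  linarith [mul_le_mul_of_nonneg_left herr (div_nonneg hη zero_le_two), mul_nonneg hη hV]

end Drift

end Descent

/-! ### The class of problems and the error of CE-LSGD -/

theorem norm_inv_smul_sum_le {M : ℕ} {E : Type*} [NormedAddCommGroup E] [NormedSpace ℝ E]
    (hM : 0 < M) (u : Fin M → E) {c : ℝ} (hu : ∀ m, ‖u m‖ ≤ c) :
    ‖(M : ℝ)⁻¹ • ∑ m, u m‖ ≤ c := by
  have hM' : (0 : ℝ) < M := by exact_mod_cast hM
  rw [norm_smul, norm_inv, Real.norm_of_nonneg hM'.le, inv_mul_le_iff₀ hM']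
  calc ‖∑ m, u m‖ ≤ ∑ _m : Fin M, c := norm_sum_le_of_le _ fun m _ => hu m
    _ = M * c := by simp

theorem hasGradientAt_avg {M d : ℕ} {F : Fin M → Vec d → ℝ} {G : Fin M → Vec d} {x : Vec d}
    (hF : ∀ m, HasGradientAt (F m) (G m) x) :
    HasGradientAt (avg F) ((M : ℝ)⁻¹ • ∑ m, G m) x := by
  rw [hasGradientAt_iff_hasFDerivAt]
  have havg : avg F = fun y => (M : ℝ)⁻¹ * ∑ m, F m y := funext fun y => div_eq_inv_mul _ _
  rw [havg]
  refine ((HasFDerivAt.fun_sum (u := Finset.univ)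
    fun m _ => (hF m).hasFDerivAt).const_mul (M : ℝ)⁻¹).congr_fderiv ?_
  ext y
  simp

namespace InClass

variable {M d : ℕ} {F : Fin M → Vec d → ℝ} {H Δ τ ζ : ℝ}

theorem hasGradientAt_avg (h : InClass F H Δ τ ζ) (x : Vec d) :
    HasGradientAt (avg F) ((M : ℝ)⁻¹ • ∑ m, gradient (F m) x) x :=
  DistOpt.hasGradientAt_avg fun m => (h.differentiable m x).hasGradientAt

theorem gradient_avg (h : InClass F H Δ τ ζ) (x : Vec d) :
    gradient (avg F) x = (M : ℝ)⁻¹ • ∑ m, gradient (F m) x :=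
  (h.hasGradientAt_avg x).gradient

theorem avg_smooth (h : InClass F H Δ τ ζ) (hM : 0 < M) (x y : Vec d) :
    ‖gradient (avg F) x - gradient (avg F) y‖ ≤ H * ‖x - y‖ := by
  rw [h.gradient_avg, h.gradient_avg, ← smul_sub, ← Finset.sum_sub_distrib]
  exact norm_inv_smul_sum_le hM _ fun m => h.smooth m x y

theorem gradient_sub_lipschitz (h : InClass F H Δ τ ζ) (m n : Fin M) (x y : Vec d) :
    ‖(gradient (F m) x - gradient (F n) x) - (gradient (F m) y - gradient (F n) y)‖
      ≤ τ * ‖x - y‖ :=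
  Convex.norm_image_sub_le_of_norm_fderiv_le (𝕜 := ℝ) (s := Set.univ)
    (f := fun x => gradient (F m) x - gradient (F n) x)
    (fun z _ => ((h.twice_differentiable m).sub (h.twice_differentiable n)) z)
    (fun z _ => by
      rw [fderiv_fun_sub (h.twice_differentiable m z) (h.twice_differentiable n z)]
      exact h.second_order m n z)
    convex_univ (Set.mem_univ _) (Set.mem_univ _)

theorem gradient_sub_avg_lipschitz (h : InClass F H Δ τ ζ) (m : Fin M) (x y : Vec d) :
    ‖(gradient (F m) x - gradient (avg F) x) - (gradient (F m) y - gradient (avg F) y)‖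
      ≤ τ * ‖x - y‖ := by
  have hM : (M : ℝ) ≠ 0 := by exact_mod_cast m.pos.ne'
  have hsub (z : Vec d) : gradient (F m) z - gradient (avg F) z
      = (M : ℝ)⁻¹ • ∑ n, (gradient (F m) z - gradient (F n) z) := by
    rw [h.gradient_avg, Finset.sum_sub_distrib, smul_sub]
    simp [← Nat.cast_smul_eq_nsmul ℝ, smul_smul, inv_mul_cancel₀ hM]
  rw [hsub, hsub, ← smul_sub, ← Finset.sum_sub_distrib]
  exact norm_inv_smul_sum_le m.pos _ fun n => h.gradient_sub_lipschitz m n x y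

theorem sum_sq_norm_gradient_localIterate_le (h : InClass F H Δ τ ζ) {η : ℝ} (hη : 0 ≤ η)
    (hτ : 0 ≤ τ) (hHη : H * η ≤ 1 / 2) {Q : ℕ} (hτη : τ * η * Q ≤ 1 / 2) (m : Fin M) (x : Vec d) :
    η / 2 * ∑ k ∈ Finset.Icc 1 Q, ‖gradient (avg F) (localIterate η F m x k)‖ ^ 2
      ≤ avg F x - avg F (localIterate η F m x (Q + 1)) := by
  have hgrad (x : Vec d) : HasGradientAt (avg F) (gradient (avg F) x) x :=
    (h.hasGradientAt_avg x).differentiableAt.hasGradientAt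
  simp only [← Finset.Ico_add_one_right_eq_Icc, Finset.sum_Ico_eq_sum_range, add_tsub_cancel_right,
    add_comm 1]
  set st := localPhase η (gradient (F m)) x ((M : ℝ)⁻¹ • ∑ n, gradient (F n) x)
  refine sum_sq_norm_gradient_le_of_drift (w := fun k => (st k).1) (v := fun k => (st k).2.2)
    hη hτ hHη hτη (le_add_inner_add_sq_of_lipschitz_gradient hgrad (h.avg_smooth m.pos)) rfl
    (h.gradient_avg x).symm (fun k => rfl) fun k => ?_
  refine le_of_eq_of_le ?_ (h.gradient_sub_avg_lipschitz m (st (k + 1)).1 (st k).1)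
  have hv : (st (k + 1)).2.2 = (st k).2.2 + gradient (F m) (st (k + 1)).1
    - gradient (F m) (st k).1 := rfl
  congr 1
  rw [hv]
  abel

end InClass

theorem localSteps_le {K : ℕ} (hK : 1 ≤ K) (r : ℕ) : localSteps K r ≤ K := by
  unfold localSteps
  split_ifs <;> omega

theorem sum_localSteps {K N : ℕ} (hN : 1 ≤ N) :
    ∑ r : Fin N, (localSteps K r : ℝ) = 1 + (N - 1) * K := by
  obtain ⟨n, rfl⟩ := Nat.exists_eq_add_of_le' hN
  rw [Fin.sum_univ_succ]
  simp [localSteps]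

theorem celsgdError_le_of_forall {M d : ℕ} {η : ℝ} {K N : ℕ} {F : Fin M → Vec d → ℝ} {B : ℝ}
    (hM : 0 < M)
    (hB : ∀ client : ℕ → Fin M, (∑ r ∈ Finset.range N, ∑ k ∈ Finset.Icc 1 (localSteps K r),
      ‖gradient (avg F) (localIterate η F (client r) (serverIterate η K F client r) k)‖ ^ 2)
      / (∑ r : Fin N, (localSteps K r : ℝ)) ≤ B) :
    celsgdError η K N F ≤ B := by
  have hrun (client : Fin N → Fin M) : (∑ r : Fin N, ∑ k ∈ Finset.Icc 1 (localSteps K r),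
      ‖gradient (avg F) (localIterate η F (client r)
        (serverIterate η K F (fun i => client ⟨i % N, Nat.mod_lt i r.pos⟩) r) k)‖ ^ 2)
      / (∑ r : Fin N, (localSteps K r : ℝ)) ≤ B := by
    rcases Nat.eq_zero_or_pos N with rfl | hN
    · simpa using hB fun _ => ⟨0, hM⟩
    have hperiodic (r : Fin N) : client ⟨(r : ℕ) % N, Nat.mod_lt _ hN⟩ = client r := by
      congr 1; ext; exact Nat.mod_eq_of_lt r.isLt
    simpa only [← Fin.sum_univ_eq_sum_range, hperiodic] using
      hB fun i => client ⟨i % N, Nat.mod_lt i hN⟩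
  have hM' : (0 : ℝ) < M := by exact_mod_cast hM
  unfold celsgdError
  rw [div_le_iff₀ (by positivity)]
  refine (Finset.sum_le_sum fun client _ => hrun client).trans (le_of_eq ?_)
  rw [Finset.sum_const, Finset.card_univ, Fintype.card_fun, Fintype.card_fin, Fintype.card_fin,
    nsmul_eq_mul, Nat.cast_pow, mul_comm]

namespace InClass

variable {M d : ℕ} {F : Fin M → Vec d → ℝ} {H Δ τ ζ : ℝ}

theorem sum_sq_norm_gradient_run_le (h : InClass F H Δ τ ζ) {η : ℝ} (hη : 0 ≤ η)
    (hτ : 0 ≤ τ) (hHη : H * η ≤ 1 / 2) {K : ℕ} (hK : 1 ≤ K) (hτη : τ * η * K ≤ 1 / 2)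
    (client : ℕ → Fin M) (N : ℕ) :
    η / 2 * ∑ r ∈ Finset.range N, ∑ k ∈ Finset.Icc 1 (localSteps K r),
      ‖gradient (avg F) (localIterate η F (client r) (serverIterate η K F client r) k)‖ ^ 2
      ≤ avg F 0 - avg F (serverIterate η K F client N) := by
  induction N with
  | zero => simp [serverIterate]
  | succ N ih =>
    have hQ : τ * η * localSteps K N ≤ 1 / 2 :=
      le_trans (by gcongr; exact localSteps_le hK N) hτη
    have hphase := h.sum_sq_norm_gradient_localIterate_le hη hτ hHη hQ (client N)
      (serverIterate η K F client N)
    rw [Finset.sum_range_succ, mul_add, serverIterate]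
    linarith

theorem celsgdError_le (h : InClass F H Δ τ ζ) (hM : 0 < M) (hH : 0 < H) (hΔ : 0 ≤ Δ) (hτ : 0 ≤ τ)
    {K N : ℕ} (hK : 1 ≤ K) (hN : 2 ≤ N) :
    celsgdError (1 / 2 / max H (K * τ)) K N F ≤ 8 * (Δ * H / (K * N) + Δ * τ / N) := by
  set B := max H (K * τ)
  have hB : 0 < B := lt_max_of_lt_left hH
  set η := 1 / 2 / B with hη_def
  have hη : 0 < η := by positivity
  have hηB : B * η = 1 / 2 := by rw [hη_def]; field_simp
  have hHη : H * η ≤ 1 / 2 := hηB ▸ by gcongr; exact le_max_left _ _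
  have hτη : τ * η * K ≤ 1 / 2 := by
    rw [mul_right_comm, mul_comm τ, ← hηB]; gcongr; exact le_max_right _ _
  have hN' : (2 : ℝ) ≤ N := by exact_mod_cast hN
  have hK' : (1 : ℝ) ≤ K := by exact_mod_cast hK
  have hsteps : N * K / 2 ≤ 1 + ((N : ℝ) - 1) * K := by nlinarith
  have hNK : (0 : ℝ) < N * K := by positivity
  refine celsgdError_le_of_forall hM fun client => ?_
  rw [sum_localSteps (by omega), div_le_iff₀ (by linarith)]
  set S := ∑ r ∈ Finset.range N, ∑ k ∈ Finset.Icc 1 (localSteps K r),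
    ‖gradient (avg F) (localIterate η F (client r) (serverIterate η K F client r) k)‖ ^ 2
  have hS : η / 2 * S ≤ Δ :=
    (h.sum_sq_norm_gradient_run_le hη.le hτ hHη hK hτη client N).trans (h.subopt _)
  calc S = 4 * B * (η / 2 * S) := by linear_combination (-2 * S) * hηB
    _ ≤ 4 * B * Δ := by gcongr
    _ ≤ 4 * (H + K * τ) * Δ := by
      gcongr; exact max_le (le_add_of_nonneg_right (by positivity)) (le_add_of_nonneg_left hH.le)
    _ = 8 * (Δ * H / (K * N) + Δ * τ / N) * (N * K / 2) := by field_simp; ring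
    _ ≤ 8 * (Δ * H / (K * N) + Δ * τ / N) * (1 + (N - 1) * K) := by gcongr

end InClass

/-! ### The links of the hard chain -/

/-- A smooth step from `0` on `(-∞, 1/2]` to `1` on `[1, ∞)`. -/
noncomputable def smoothStep (u : ℝ) : ℝ := Real.smoothTransition (2 * u - 1)

theorem contDiff_smoothStep {n : ℕ∞} : ContDiff ℝ n smoothStep :=
  Real.smoothTransition.contDiff.comp (by fun_prop)

theorem smoothStep_nonneg (u : ℝ) : 0 ≤ smoothStep u := Real.smoothTransition.nonneg _

theorem smoothStep_le_one (u : ℝ) : smoothStep u ≤ 1 := Real.smoothTransition.le_one _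

theorem smoothStep_eq_zero {u : ℝ} (hu : u ≤ 1 / 2) : smoothStep u = 0 :=
  Real.smoothTransition.zero_of_nonpos (by linarith)

theorem smoothStep_eq_one {u : ℝ} (hu : 1 ≤ u) : smoothStep u = 1 :=
  Real.smoothTransition.one_of_one_le (by linarith)

theorem deriv_smoothStep_nonneg (u : ℝ) : 0 ≤ deriv smoothStep u :=
  Monotone.deriv_nonneg fun _ _ h => Real.smoothTransition.monotone (by linarith)

theorem deriv_smoothStep_of_lt {u : ℝ} (hu : u < 1 / 2) : deriv smoothStep u = 0 := by
  have hconst : smoothStep =ᶠ[nhds u] fun _ => 0 := by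
    filter_upwards [Iio_mem_nhds hu] with v hv using smoothStep_eq_zero (le_of_lt hv)
  rw [hconst.deriv_eq, deriv_const]

theorem deriv_smoothStep_of_gt {u : ℝ} (hu : 1 < u) : deriv smoothStep u = 0 := by
  have hconst : smoothStep =ᶠ[nhds u] fun _ => 1 := by
    filter_upwards [Ioi_mem_nhds hu] with v hv using smoothStep_eq_one (le_of_lt hv)
  rw [hconst.deriv_eq, deriv_const]

theorem contDiff_deriv_smoothStep : ContDiff ℝ 1 (deriv smoothStep) :=
  (contDiff_succ_iff_deriv.1 (contDiff_smoothStep (n := 2))).2.2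

theorem hasDerivAt_smoothStep (u : ℝ) : HasDerivAt smoothStep (deriv smoothStep u) u :=
  (contDiff_smoothStep.differentiable one_ne_zero u).hasDerivAt

theorem hasCompactSupport_deriv_smoothStep : HasCompactSupport (deriv smoothStep) := by
  refine HasCompactSupport.intro (isCompact_Icc (a := (1 / 2 : ℝ)) (b := 1)) fun u hu => ?_
  rcases not_and_or.1 hu with h | h
  · exact deriv_smoothStep_of_lt (not_le.1 h)
  · exact deriv_smoothStep_of_gt (not_le.1 h)

theorem exists_stepBound : ∃ L : ℝ, 1 ≤ L ∧ (∀ u, deriv smoothStep u ≤ L) ∧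
    ∀ u v, |deriv smoothStep u - deriv smoothStep v| ≤ L * |u - v| := by
  obtain ⟨C, hC⟩ := hasCompactSupport_deriv_smoothStep.exists_bound_of_continuous
    contDiff_deriv_smoothStep.continuous
  obtain ⟨C', hC'⟩ := ContDiff.lipschitzWith_of_hasCompactSupport
    hasCompactSupport_deriv_smoothStep contDiff_deriv_smoothStep one_ne_zero
  refine ⟨max 1 (max C C'), le_max_left _ _, fun u => ?_, fun u v => ?_⟩
  · exact (le_abs_self _).trans ((hC u).trans ((le_max_left _ _).trans (le_max_right _ _)))
  · refine (hC'.dist_le_mul u v).trans (mul_le_mul_of_nonneg_right ?_ dist_nonneg)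
    exact (le_max_right _ _).trans (le_max_right _ _)

/-- A constant, at least `1`, bounding both the derivative of `smoothStep` and the Lipschitz
constant of that derivative. -/
noncomputable def stepBound : ℝ := exists_stepBound.choose

theorem one_le_stepBound : 1 ≤ stepBound := exists_stepBound.choose_spec.1

theorem stepBound_pos : 0 < stepBound := one_pos.trans_le one_le_stepBound

theorem deriv_smoothStep_le (u : ℝ) : deriv smoothStep u ≤ stepBound :=
  exists_stepBound.choose_spec.2.1 u

theorem abs_deriv_smoothStep_sub_le (u v : ℝ) :
    |deriv smoothStep u - deriv smoothStep v| ≤ stepBound * |u - v| :=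
  exists_stepBound.choose_spec.2.2 u v

theorem abs_sub_le_of_abs_deriv_le {f f' : ℝ → ℝ} {C : ℝ} (hf : ∀ u, HasDerivAt f (f' u) u)
    (hC : ∀ u, |f' u| ≤ C) (u v : ℝ) : |f u - f v| ≤ C * |u - v| :=
  Convex.norm_image_sub_le_of_norm_hasDerivWithin_le (s := Set.univ)
    (fun x _ => (hf x).hasDerivWithinAt) (fun x _ => hC x) convex_univ (Set.mem_univ v)
    (Set.mem_univ u)

/-- The function `u ↦ ψ |u|` for the smooth step `ψ`: it vanishes on `[-1/2, 1/2]` and is `1`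
outside `(-1, 1)`. -/
noncomputable def gate (u : ℝ) : ℝ := smoothStep u + smoothStep (-u)

theorem smoothStep_eq_zero_or (u : ℝ) : smoothStep u = 0 ∨ smoothStep (-u) = 0 := by
  rcases le_total u 0 with h | h
  · exact Or.inl (smoothStep_eq_zero (by linarith))
  · exact Or.inr (smoothStep_eq_zero (by linarith))

theorem gate_nonneg (u : ℝ) : 0 ≤ gate u :=
  add_nonneg (smoothStep_nonneg _) (smoothStep_nonneg _)

theorem gate_le_one (u : ℝ) : gate u ≤ 1 := by
  rcases smoothStep_eq_zero_or u with h | h <;> simp [gate, h, smoothStep_le_one]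

theorem gate_eq_zero {u : ℝ} (hu : |u| ≤ 1 / 2) : gate u = 0 := by
  rw [abs_le] at hu
  rw [gate, smoothStep_eq_zero hu.2, smoothStep_eq_zero (by linarith), add_zero]

theorem gate_zero : gate 0 = 0 := gate_eq_zero (by norm_num)

theorem gate_eq_one {u : ℝ} (hu : 1 ≤ |u|) : gate u = 1 := by
  rcases le_abs.1 hu with h | h
  · rw [gate, smoothStep_eq_one h, smoothStep_eq_zero (by linarith), add_zero]
  · rw [gate, smoothStep_eq_one h, smoothStep_eq_zero (by linarith), zero_add]

theorem hasDerivAt_smoothStep_neg (u : ℝ) :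
    HasDerivAt (fun u => smoothStep (-u)) (-deriv smoothStep (-u)) u :=
  ((hasDerivAt_smoothStep (-u)).comp u (hasDerivAt_neg u)).congr_deriv (by ring)

theorem hasDerivAt_gate (u : ℝ) :
    HasDerivAt gate (deriv smoothStep u - deriv smoothStep (-u)) u :=
  ((hasDerivAt_smoothStep u).add (hasDerivAt_smoothStep_neg u)).congr_deriv (by ring)

theorem abs_gate_sub_le (u v : ℝ) : |gate u - gate v| ≤ stepBound * |u - v| := by
  refine abs_sub_le_of_abs_deriv_le hasDerivAt_gate (fun u => abs_le.2 ⟨?_, ?_⟩) u v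
  · linarith [deriv_smoothStep_nonneg u, deriv_smoothStep_le (-u)]
  · linarith [deriv_smoothStep_nonneg (-u), deriv_smoothStep_le u]

theorem abs_inv_one_add_sq_sub_le (u v : ℝ) : |(1 + u ^ 2)⁻¹ - (1 + v ^ 2)⁻¹| ≤ |u - v| := by
  have hu : 0 < 1 + u ^ 2 := by positivity
  have hv : 0 < 1 + v ^ 2 := by positivity
  have hsub : (1 + u ^ 2)⁻¹ - (1 + v ^ 2)⁻¹
      = (v - u) * (u + v) / ((1 + u ^ 2) * (1 + v ^ 2)) := by
    field_simp; ring
  rw [hsub, abs_div, abs_mul, abs_of_pos (mul_pos hu hv), div_le_iff₀ (mul_pos hu hv),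
    abs_sub_comm v u]
  refine mul_le_mul_of_nonneg_left (abs_le.2 ?_) (abs_nonneg _)
  constructor <;> nlinarith [sq_nonneg (u - 1), sq_nonneg (v - 1), sq_nonneg (u + 1),
    sq_nonneg (v + 1), sq_nonneg (u * v)]

theorem inv_one_add_sq_nonneg (v : ℝ) : 0 ≤ (1 + v ^ 2)⁻¹ := by positivity

theorem inv_one_add_sq_le_one (v : ℝ) : (1 + v ^ 2)⁻¹ ≤ 1 :=
  inv_le_one_of_one_le₀ (by linarith [sq_nonneg v])

/-- The arctangent, shifted so as to be positive. -/
noncomputable def posArctan (v : ℝ) : ℝ := Real.pi / 2 + Real.arctan v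

theorem posArctan_nonneg (v : ℝ) : 0 ≤ posArctan v := by
  unfold posArctan
  linarith [Real.neg_pi_div_two_lt_arctan v]

theorem posArctan_le_four (v : ℝ) : posArctan v ≤ 4 := by
  unfold posArctan
  linarith [Real.arctan_lt_pi_div_two v, Real.pi_le_four]

theorem hasDerivAt_posArctan (v : ℝ) : HasDerivAt posArctan (1 + v ^ 2)⁻¹ v :=
  (Real.hasDerivAt_arctan' v).const_add _

theorem abs_posArctan_sub_le (u v : ℝ) : |posArctan u - posArctan v| ≤ |u - v| := by
  simpa using abs_sub_le_of_abs_deriv_le hasDerivAt_posArctan (C := 1)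
    (fun u => by simpa [abs_of_nonneg (inv_one_add_sq_nonneg u)] using inv_one_add_sq_le_one u) u v

/-- A link `ψ(u) Φ(v) - ψ(-u) Φ(-v)` of the chain of Carmon, Duchi, Hinder and Sidford: the variable
`v` is invisible unless `1/2 < |u|`. -/
noncomputable def link (u v : ℝ) : ℝ :=
  smoothStep u * posArctan v - smoothStep (-u) * posArctan (-v)

/-- The partial derivative of `link` in its first argument. -/
noncomputable def linkFst (u v : ℝ) : ℝ :=
  deriv smoothStep u * posArctan v + deriv smoothStep (-u) * posArctan (-v)

/-- The partial derivative of `link` in its second argument. -/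
noncomputable def linkSnd (u v : ℝ) : ℝ := gate u * (1 + v ^ 2)⁻¹

theorem abs_link_le (u v : ℝ) : |link u v| ≤ 4 := by
  have hle (a b : ℝ) : smoothStep a * posArctan b ≤ 1 * 4 :=
    mul_le_mul (smoothStep_le_one a) (posArctan_le_four b) (posArctan_nonneg b) zero_le_one
  have hpos (a b : ℝ) : 0 ≤ smoothStep a * posArctan b :=
    mul_nonneg (smoothStep_nonneg a) (posArctan_nonneg b)
  rw [link, abs_le]
  constructor <;> linarith [hle u v, hle (-u) (-v), hpos u v, hpos (-u) (-v)]

theorem hasFDerivAt_link (p : ℝ × ℝ) :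
    HasFDerivAt (fun p : ℝ × ℝ => link p.1 p.2)
      (linkFst p.1 p.2 • ContinuousLinearMap.fst ℝ ℝ ℝ +
        linkSnd p.1 p.2 • ContinuousLinearMap.snd ℝ ℝ ℝ) p := by
  have hposArctan_neg (v : ℝ) : HasDerivAt (fun v => posArctan (-v)) (-(1 + v ^ 2)⁻¹) v :=
    ((hasDerivAt_posArctan (-v)).comp v (hasDerivAt_neg v)).congr_deriv (by simp)
  refine ((((hasDerivAt_smoothStep p.1).comp_hasFDerivAt p hasFDerivAt_fst).mul
    ((hasDerivAt_posArctan p.2).comp_hasFDerivAt p hasFDerivAt_snd)).sub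
    (((hasDerivAt_smoothStep_neg p.1).comp_hasFDerivAt p hasFDerivAt_fst).mul
    ((hposArctan_neg p.2).comp_hasFDerivAt p hasFDerivAt_snd))).congr_fderiv ?_
  ext <;> simp [linkFst, linkSnd, gate] <;> ring

theorem differentiable_deriv_smoothStep : Differentiable ℝ (deriv smoothStep) :=
  contDiff_deriv_smoothStep.differentiable one_ne_zero

theorem differentiable_posArctan : Differentiable ℝ posArctan :=
  fun v => (hasDerivAt_posArctan v).differentiableAt

theorem differentiable_linkFst : Differentiable ℝ fun p : ℝ × ℝ => linkFst p.1 p.2 :=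
  ((differentiable_deriv_smoothStep.comp differentiable_fst).mul
    (differentiable_posArctan.comp differentiable_snd)).add
  ((differentiable_deriv_smoothStep.comp differentiable_fst.neg).mul
    (differentiable_posArctan.comp differentiable_snd.neg))

theorem differentiable_linkSnd : Differentiable ℝ fun p : ℝ × ℝ => linkSnd p.1 p.2 := by
  have hgate : Differentiable ℝ gate := fun u => (hasDerivAt_gate u).differentiableAt
  refine (hgate.comp differentiable_fst).mul (Differentiable.inv (by fun_prop) fun p => ?_)
  positivity

theorem linkFst_nonneg (u v : ℝ) : 0 ≤ linkFst u v :=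
  add_nonneg (mul_nonneg (deriv_smoothStep_nonneg _) (posArctan_nonneg _))
    (mul_nonneg (deriv_smoothStep_nonneg _) (posArctan_nonneg _))

theorem linkFst_le (u v : ℝ) : linkFst u v ≤ 8 * stepBound := by
  have hle (a b : ℝ) : deriv smoothStep a * posArctan b ≤ stepBound * 4 :=
    mul_le_mul (deriv_smoothStep_le a) (posArctan_le_four b) (posArctan_nonneg b) stepBound_pos.le
  unfold linkFst
  linarith [hle u v, hle (-u) (-v)]

theorem linkFst_zero_left (v : ℝ) : linkFst 0 v = 0 := by
  simp [linkFst, deriv_smoothStep_of_lt]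

theorem linkSnd_nonneg (u v : ℝ) : 0 ≤ linkSnd u v :=
  mul_nonneg (gate_nonneg u) (inv_one_add_sq_nonneg v)

theorem linkSnd_le_one (u v : ℝ) : linkSnd u v ≤ 1 :=
  mul_le_one₀ (gate_le_one u) (inv_one_add_sq_nonneg v) (inv_one_add_sq_le_one v)

theorem linkSnd_zero_right (u : ℝ) : linkSnd u 0 = gate u := by simp [linkSnd]

theorem half_le_linkSnd {u v : ℝ} (hu : 1 ≤ |u|) (hv : |v| ≤ 1) : 1 / 2 ≤ linkSnd u v := by
  rw [linkSnd, gate_eq_one hu, one_mul, one_div]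
  exact inv_anti₀ (by positivity) (by linarith [(sq_le_one_iff_abs_le_one v).2 hv])

theorem abs_mul_sub_mul_le {a b a' b' A B : ℝ} (hb : |b| ≤ B) (ha' : |a'| ≤ A) :
    |a * b - a' * b'| ≤ B * |a - a'| + A * |b - b'| :=
  calc |a * b - a' * b'| = |b * (a - a') + a' * (b - b')| := by ring_nf
    _ ≤ |b| * |a - a'| + |a'| * |b - b'| := by rw [← abs_mul, ← abs_mul]; exact abs_add_le _ _
    _ ≤ B * |a - a'| + A * |b - b'| := by gcongr

theorem abs_linkFst_sub_le (u v u' v' : ℝ) :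
    |linkFst u v - linkFst u' v'| ≤ 8 * stepBound * (|u - u'| + |v - v'|) := by
  have hterm (a b a' b' : ℝ) :
      |deriv smoothStep a * posArctan b - deriv smoothStep a' * posArctan b'|
      ≤ 4 * (stepBound * |a - a'|) + stepBound * |b - b'| := by
    refine (abs_mul_sub_mul_le (B := 4) (A := stepBound) ?_ ?_).trans ?_
    · rw [abs_of_nonneg (posArctan_nonneg b)]; exact posArctan_le_four b
    · rw [abs_of_nonneg (deriv_smoothStep_nonneg a')]; exact deriv_smoothStep_le a'
    · exact add_le_add (mul_le_mul_of_nonneg_left (abs_deriv_smoothStep_sub_le a a') zero_le_four)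
        (mul_le_mul_of_nonneg_left (abs_posArctan_sub_le b b') stepBound_pos.le)
  have hneg (a a' : ℝ) : |-a - -a'| = |a - a'| := by rw [← abs_neg]; ring_nf
  have hfst := hterm u v u' v'
  have hsnd := hterm (-u) (-v) (-u') (-v')
  rw [hneg, hneg] at hsnd
  have hL := mul_nonneg stepBound_pos.le (abs_nonneg (v - v'))
  unfold linkFst
  rw [add_sub_add_comm]
  linarith [abs_add_le (deriv smoothStep u * posArctan v - deriv smoothStep u' * posArctan v')
    (deriv smoothStep (-u) * posArctan (-v) - deriv smoothStep (-u') * posArctan (-v'))]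

theorem abs_linkSnd_sub_le (u v u' v' : ℝ) :
    |linkSnd u v - linkSnd u' v'| ≤ 8 * stepBound * (|u - u'| + |v - v'|) := by
  have hL := one_le_stepBound
  calc |linkSnd u v - linkSnd u' v'|
      ≤ 1 * |gate u - gate u'| + 1 * |(1 + v ^ 2)⁻¹ - (1 + v' ^ 2)⁻¹| := by
        refine abs_mul_sub_mul_le ?_ ?_
        · rw [abs_of_nonneg (inv_one_add_sq_nonneg v)]; exact inv_one_add_sq_le_one v
        · rw [abs_of_nonneg (gate_nonneg u')]; exact gate_le_one u'
    _ ≤ stepBound * |u - u'| + |v - v'| := by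
        rw [one_mul, one_mul]
        exact add_le_add (abs_gate_sub_le u u') (abs_inv_one_add_sq_sub_le v v')
    _ ≤ 8 * stepBound * (|u - u'| + |v - v'|) := by
        nlinarith [mul_nonneg (sub_nonneg.2 hL) (abs_nonneg (v - v')), abs_nonneg (v - v'),
          mul_nonneg stepBound_pos.le (abs_nonneg (u - u')), stepBound_pos]

/-! ### The hard chain -/

section Chain

variable {T : ℕ}

/-- The sequence `1, x₀, x₁, …, x_{T-1}, 0, 0, …`, whose leading `1` makes link `0` of the chain
active. Coordinate `i` of `x` is entry `i + 1`. -/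
noncomputable def pad (x : Vec T) : ℕ → ℝ
  | 0 => 1
  | k + 1 => if h : k < T then x ⟨k, h⟩ else 0

/-- The derivative of the affine map `x ↦ pad x k`. -/
noncomputable def padDeriv (T : ℕ) : ℕ → (Vec T →L[ℝ] ℝ)
  | 0 => 0
  | k + 1 => if h : k < T then EuclideanSpace.proj ⟨k, h⟩ else 0

@[simp] theorem pad_zero (x : Vec T) : pad x 0 = 1 := rfl

@[simp] theorem pad_fin_succ (x : Vec T) (i : Fin T) : pad x (i + 1) = x i := by simp [pad]

@[simp] theorem padDeriv_zero : padDeriv T 0 = 0 := rfl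

@[simp] theorem padDeriv_fin_succ (v : Vec T) (i : Fin T) : padDeriv T (i + 1) v = v i := by
  simp [padDeriv]

theorem padDeriv_of_lt {k : ℕ} (hk : T < k) : padDeriv T k = 0 := by
  obtain ⟨k, rfl⟩ := Nat.exists_eq_add_of_lt hk
  simp [padDeriv]

theorem pad_sub_pad (x y : Vec T) (k : ℕ) : pad x k - pad y k = padDeriv T k (x - y) := by
  cases k with
  | zero => simp
  | succ k => by_cases h : k < T <;> simp [pad, padDeriv, h]

theorem hasFDerivAt_pad (k : ℕ) (x : Vec T) : HasFDerivAt (fun x => pad x k) (padDeriv T k) x := by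
  have hpad : (fun x : Vec T => pad x k) = fun x => pad (0 : Vec T) k + padDeriv T k x := by
    funext x
    rw [← sub_zero x, ← pad_sub_pad, sub_zero]
    ring
  rw [hpad]
  exact (padDeriv T k).hasFDerivAt.const_add _

theorem hasFDerivAt_pad_prod (k : ℕ) (x : Vec T) :
    HasFDerivAt (fun x => (pad x k, pad x (k + 1))) ((padDeriv T k).prod (padDeriv T (k + 1))) x :=
  (hasFDerivAt_pad k x).prodMk (hasFDerivAt_pad (k + 1) x)

theorem sum_sq_padDeriv_le (s : Finset ℕ) (v : Vec T) : ∑ k ∈ s, padDeriv T k v ^ 2 ≤ ‖v‖ ^ 2 := by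
  have hzero : ∀ k ∈ s ∪ Finset.range (T + 1), k ∉ Finset.range (T + 1) →
      padDeriv T k v ^ 2 = 0 := by
    intro k _ hk
    rw [padDeriv_of_lt (by simpa using hk)]
    simp
  calc ∑ k ∈ s, padDeriv T k v ^ 2 ≤ ∑ k ∈ s ∪ Finset.range (T + 1), padDeriv T k v ^ 2 :=
        Finset.sum_le_sum_of_subset_of_nonneg Finset.subset_union_left fun _ _ _ => sq_nonneg _
    _ = ∑ k ∈ Finset.range (T + 1), padDeriv T k v ^ 2 :=
        (Finset.sum_subset Finset.subset_union_right hzero).symm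
    _ = ‖v‖ ^ 2 := by
        rw [Finset.sum_range_succ', EuclideanSpace.real_norm_sq_eq,
          ← Fin.sum_univ_eq_sum_range (fun k => padDeriv T (k + 1) v ^ 2)]
        simp

theorem sum_sq_padDeriv_add_le (v : Vec T) (j : ℕ) :
    ∑ i : Fin T, padDeriv T (i + j) v ^ 2 ≤ ‖v‖ ^ 2 := by
  rw [Fin.sum_univ_eq_sum_range (fun k => padDeriv T (k + j) v ^ 2), Finset.range_eq_Ico,
    Finset.sum_Ico_add' (fun k => padDeriv T k v ^ 2)]
  exact sum_sq_padDeriv_le _ v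

theorem norm_le_of_abs_apply_le {u v : Vec T} {C : ℝ} (hC : 0 ≤ C)
    (h : ∀ i : Fin T, |u i| ≤
      C * (|padDeriv T i v| + 2 * |padDeriv T (i + 1) v| + |padDeriv T (i + 2) v|)) :
    ‖u‖ ≤ 4 * C * ‖v‖ := by
  have hsq (i : Fin T) : u i ^ 2 ≤ 4 * C ^ 2 *
      (padDeriv T i v ^ 2 + 2 * padDeriv T (i + 1) v ^ 2 + padDeriv T (i + 2) v ^ 2) := by
    have hcauchy (p q r : ℝ) :
        (|p| + 2 * |q| + |r|) ^ 2 ≤ 4 * (p ^ 2 + 2 * q ^ 2 + r ^ 2) := by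
      rw [← sq_abs p, ← sq_abs q, ← sq_abs r]
      nlinarith [sq_nonneg (|p| - |q|), sq_nonneg (|q| - |r|), sq_nonneg (|p| - |r|)]
    calc u i ^ 2 = |u i| ^ 2 := (sq_abs _).symm
      _ ≤ (C * _) ^ 2 := pow_le_pow_left₀ (abs_nonneg _) (h i) 2
      _ ≤ C ^ 2 * (4 * _) := by rw [mul_pow]; gcongr; exact hcauchy _ _ _
      _ = _ := by ring
  refine le_of_sq_le_sq ?_ (by positivity)
  rw [EuclideanSpace.real_norm_sq_eq]
  calc ∑ i, u i ^ 2 ≤ 4 * C ^ 2 * (∑ i : Fin T, padDeriv T (i + 0) v ^ 2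
        + 2 * ∑ i : Fin T, padDeriv T (i + 1) v ^ 2 + ∑ i : Fin T, padDeriv T (i + 2) v ^ 2) := by
        rw [Finset.mul_sum, ← Finset.sum_add_distrib, ← Finset.sum_add_distrib, Finset.mul_sum]
        exact Finset.sum_le_sum fun i _ => hsq i
    _ ≤ 4 * C ^ 2 * (‖v‖ ^ 2 + 2 * ‖v‖ ^ 2 + ‖v‖ ^ 2) := by
        gcongr <;> exact sum_sq_padDeriv_add_le v _
    _ = (4 * C * ‖v‖) ^ 2 := by ring

/-- The hard chain whose link `k` has weight `w k`. -/
noncomputable def chain (w : ℕ → ℝ) (x : Vec T) : ℝ :=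
  -∑ k ∈ Finset.range (T + 1), w k * link (pad x k) (pad x (k + 1))

/-- The gradient of `chain w`. -/
noncomputable def chainGrad (w : ℕ → ℝ) (x : Vec T) : Vec T :=
  WithLp.toLp 2 fun i => -(w (i + 1) * linkFst (pad x (i + 1)) (pad x (i + 2))
    + w i * linkSnd (pad x i) (pad x (i + 1)))

theorem chainGrad_apply (w : ℕ → ℝ) (x : Vec T) (i : Fin T) :
    chainGrad w x i = -(w (i + 1) * linkFst (pad x (i + 1)) (pad x (i + 2))
      + w i * linkSnd (pad x i) (pad x (i + 1))) := rfl

theorem hasFDerivAt_chain (w : ℕ → ℝ) (x : Vec T) :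
    HasFDerivAt (chain w) (-∑ k ∈ Finset.range (T + 1), w k •
      (linkFst (pad x k) (pad x (k + 1)) • padDeriv T k
        + linkSnd (pad x k) (pad x (k + 1)) • padDeriv T (k + 1))) x := by
  refine (HasFDerivAt.fun_sum fun k _ => HasFDerivAt.congr_fderiv
    (((hasFDerivAt_link _).comp x (hasFDerivAt_pad_prod k x)).const_mul (w k)) ?_).neg
  ext v
  simp

theorem hasGradientAt_chain (w : ℕ → ℝ) (x : Vec T) :
    HasGradientAt (chain w) (chainGrad w x) x := by
  rw [hasGradientAt_iff_hasFDerivAt]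
  refine (hasFDerivAt_chain w x).congr_fderiv ?_
  ext v
  have hfst := Finset.sum_range_succ'
    (fun k => w k * (linkFst (pad x k) (pad x (k + 1)) * padDeriv T k v)) T
  have hsnd := Finset.sum_range_succ
    (fun k => w k * (linkSnd (pad x k) (pad x (k + 1)) * padDeriv T (k + 1) v)) T
  rw [padDeriv_of_lt (Nat.lt_succ_self T)] at hsnd
  simp only [padDeriv_zero, zero_apply, mul_zero, add_zero] at hfst hsnd
  simp only [neg_apply, sum_apply, add_apply, smul_apply, smul_eq_mul, mul_add,
    Finset.sum_add_distrib, hfst, hsnd, InnerProductSpace.toDual_apply_apply, PiLp.inner_apply]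
  rw [← Finset.sum_add_distrib, ← Finset.sum_neg_distrib, ← Fin.sum_univ_eq_sum_range]
  refine Finset.sum_congr rfl fun i _ => ?_
  simp [chainGrad_apply]
  ring

theorem differentiable_chainGrad (w : ℕ → ℝ) : Differentiable ℝ (chainGrad w : Vec T → Vec T) := by
  have hpad (k : ℕ) : Differentiable ℝ fun x : Vec T => (pad x k, pad x (k + 1)) :=
    fun x => (hasFDerivAt_pad_prod k x).differentiableAt
  rw [differentiable_euclidean]
  exact fun i => (((differentiable_linkFst.comp (hpad (i + 1))).const_mul _).add
    ((differentiable_linkSnd.comp (hpad i)).const_mul _)).neg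

theorem chainGrad_sub (w w' : ℕ → ℝ) (x : Vec T) :
    chainGrad w x - chainGrad w' x = chainGrad (w - w') x := by
  ext i
  simp only [PiLp.sub_apply, chainGrad_apply, Pi.sub_apply]
  ring

theorem inv_smul_sum_chainGrad {M : ℕ} (w : Fin M → ℕ → ℝ) (x : Vec T) :
    (M : ℝ)⁻¹ • ∑ m, chainGrad (w m) x = chainGrad (fun k => (M : ℝ)⁻¹ * ∑ m, w m k) x := by
  ext i
  simp only [PiLp.smul_apply, WithLp.ofLp_sum, Finset.sum_apply, chainGrad_apply, smul_eq_mul,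
    Finset.sum_neg_distrib, Finset.sum_add_distrib, ← Finset.sum_mul]
  ring

theorem norm_chainGrad_sub_le {w : ℕ → ℝ} {B : ℝ} (hB : ∀ k, |w k| ≤ B) (x y : Vec T) :
    ‖chainGrad w x - chainGrad w y‖ ≤ 32 * stepBound * B * ‖x - y‖ := by
  have hB0 : 0 ≤ B := (abs_nonneg _).trans (hB 0)
  have hL := stepBound_pos
  rw [show 32 * stepBound * B = 4 * (B * (8 * stepBound)) by ring]
  refine norm_le_of_abs_apply_le (by positivity) fun i => ?_
  have hfst := mul_le_mul (hB (i + 1)) (abs_linkFst_sub_le (pad x (i + 1)) (pad x (i + 2))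
    (pad y (i + 1)) (pad y (i + 2))) (abs_nonneg _) hB0
  have hsnd := mul_le_mul (hB i) (abs_linkSnd_sub_le (pad x i) (pad x (i + 1))
    (pad y i) (pad y (i + 1))) (abs_nonneg _) hB0
  simp only [← abs_mul, pad_sub_pad] at hfst hsnd
  calc |(chainGrad w x - chainGrad w y) i|
      = |w (i + 1) * (linkFst (pad x (i + 1)) (pad x (i + 2))
            - linkFst (pad y (i + 1)) (pad y (i + 2)))
          + w i * (linkSnd (pad x i) (pad x (i + 1)) - linkSnd (pad y i) (pad y (i + 1)))| := by
        rw [PiLp.sub_apply, chainGrad_apply, chainGrad_apply, ← abs_neg]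
        ring_nf
    _ ≤ _ := (abs_add_le _ _).trans (add_le_add hfst hsnd)
    _ = _ := by ring

theorem norm_sq_chainGrad_le {w : ℕ → ℝ} {B : ℝ} (hB : ∀ k, |w k| ≤ B) (x : Vec T) :
    ‖chainGrad w x‖ ^ 2 ≤ (9 * stepBound * B) ^ 2 * T := by
  have hB0 : 0 ≤ B := (abs_nonneg _).trans (hB 0)
  have happly (i : Fin T) : |chainGrad w x i| ≤ 9 * stepBound * B :=
    calc |chainGrad w x i|
        ≤ |w (i + 1)| * |linkFst (pad x (i + 1)) (pad x (i + 2))|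
          + |w i| * |linkSnd (pad x i) (pad x (i + 1))| := by
          rw [chainGrad_apply, abs_neg, ← abs_mul, ← abs_mul]; exact abs_add_le _ _
      _ ≤ B * (8 * stepBound) + B * 1 := by
          rw [abs_of_nonneg (linkFst_nonneg _ _), abs_of_nonneg (linkSnd_nonneg _ _)]
          exact add_le_add (mul_le_mul (hB _) (linkFst_le _ _) (linkFst_nonneg _ _) hB0)
            (mul_le_mul (hB _) (linkSnd_le_one _ _) (linkSnd_nonneg _ _) hB0)
      _ ≤ 9 * stepBound * B := by
          linarith [mul_le_mul_of_nonneg_left one_le_stepBound hB0]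
  rw [EuclideanSpace.real_norm_sq_eq]
  calc ∑ i, chainGrad w x i ^ 2 ≤ ∑ _i : Fin T, (9 * stepBound * B) ^ 2 :=
        Finset.sum_le_sum fun i _ => (sq_abs (chainGrad w x i)).symm.trans_le
          (pow_le_pow_left₀ (abs_nonneg _) (happly i) 2)
    _ = _ := by simp [mul_comm]

theorem abs_chain_le {w : ℕ → ℝ} {B : ℝ} (hB : ∀ k, |w k| ≤ B) (x : Vec T) :
    |chain w x| ≤ 4 * B * (T + 1) := by
  rw [chain, abs_neg]
  calc |∑ k ∈ Finset.range (T + 1), w k * link (pad x k) (pad x (k + 1))|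
      ≤ ∑ _k ∈ Finset.range (T + 1), B * 4 :=
        (Finset.abs_sum_le_sum_abs _ _).trans <| Finset.sum_le_sum fun k _ => by
          rw [abs_mul]
          exact mul_le_mul (hB k) (abs_link_le _ _) (abs_nonneg _) ((abs_nonneg _).trans (hB 0))
    _ = 4 * B * (T + 1) := by simp; ring

theorem half_le_norm_chainGrad {w : ℕ → ℝ} {ω : ℝ} (hω : 0 ≤ ω) (hw : ∀ k, ω ≤ w k) {x : Vec T}
    {i₀ : Fin T} (hx : x i₀ = 0) : ω / 2 ≤ ‖chainGrad w x‖ := by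
  -- At the first coordinate `i` of modulus less than `1`, link `i` is open and its slope is at
  -- least `1/2`; the other term of entry `i` of the gradient has the same sign.
  have hex : ∃ k, |pad x (k + 1)| < 1 := ⟨i₀, by simp [hx]⟩
  obtain ⟨i, hi⟩ : ∃ i : Fin T, (i : ℕ) = Nat.find hex :=
    ⟨⟨Nat.find hex, (Nat.find_min' hex (by simp [hx])).trans_lt i₀.isLt⟩, rfl⟩
  have hprev : 1 ≤ |pad x i| := by
    rcases hj : (i : ℕ) with - | j
    · simp
    · exact not_lt.1 (Nat.find_min hex (by omega))
  have hsnd : ω * (1 / 2) ≤ w i * linkSnd (pad x i) (pad x (i + 1)) :=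
    mul_le_mul (hw i) (half_le_linkSnd hprev (hi ▸ (Nat.find_spec hex).le)) (by norm_num)
      (hω.trans (hw i))
  have hfst := mul_nonneg (hω.trans (hw (i + 1))) (linkFst_nonneg (pad x (i + 1)) (pad x (i + 2)))
  calc ω / 2 ≤ |chainGrad w x i| := by
        rw [chainGrad_apply, abs_neg]
        exact le_trans (by linarith) (le_abs_self _)
    _ ≤ ‖chainGrad w x‖ := PiLp.norm_apply_le (chainGrad w x) i

end Chain

/-! ### Progress of zero-respecting algorithms -/

/-- The vectors supported on the first `c` coordinates. -/
def prefixSpace (T c : ℕ) : Submodule ℝ (Vec T) where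
  carrier := {x | ∀ i : Fin T, c ≤ i → x i = 0}
  add_mem' hx hy i hi := by simp [hx i hi, hy i hi]
  zero_mem' _ _ := rfl
  smul_mem' a _ hx i hi := by simp [hx i hi]

section PrefixSpace

variable {T : ℕ}

theorem mem_prefixSpace_iff_supp_subset {c : ℕ} {x : Vec T} :
    x ∈ prefixSpace T c ↔ supp x ⊆ {i | (i : ℕ) < c} := by
  refine forall_congr' fun i => ?_
  rw [← not_lt, not_imp_comm]
  rfl

theorem pad_succ_of_mem_prefixSpace {c k : ℕ} {x : Vec T} (hx : x ∈ prefixSpace T c) (hk : c ≤ k) :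
    pad x (k + 1) = 0 := by
  by_cases h : k < T
  · simpa [pad, h] using hx ⟨k, h⟩ hk
  · simp [pad, h]

theorem chainGrad_apply_of_mem_prefixSpace (w : ℕ → ℝ) {c : ℕ} {x : Vec T}
    (hx : x ∈ prefixSpace T c) {i : Fin T} (hi : c ≤ i) :
    chainGrad w x i = -(w i * gate (pad x i)) := by
  rw [chainGrad_apply, pad_succ_of_mem_prefixSpace hx hi, linkFst_zero_left, linkSnd_zero_right,
    mul_zero, zero_add]

theorem gate_pad_of_mem_prefixSpace {c k : ℕ} {x : Vec T} (hx : x ∈ prefixSpace T c) (hk : c < k) :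
    gate (pad x k) = 0 := by
  obtain ⟨k, rfl⟩ := Nat.exists_eq_add_of_lt hk
  rw [pad_succ_of_mem_prefixSpace hx (by omega), gate_zero]

theorem chainGrad_mem_prefixSpace_succ (w : ℕ → ℝ) {c : ℕ} {x : Vec T}
    (hx : x ∈ prefixSpace T c) : chainGrad w x ∈ prefixSpace T (c + 1) := fun i hi => by
  rw [chainGrad_apply_of_mem_prefixSpace w hx (by omega), gate_pad_of_mem_prefixSpace hx hi,
    mul_zero, neg_zero]

theorem chainGrad_mem_prefixSpace {w : ℕ → ℝ} {c : ℕ} (hw : w c = 0) {x : Vec T}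
    (hx : x ∈ prefixSpace T c) : chainGrad w x ∈ prefixSpace T c := fun i hi => by
  rcases hi.eq_or_lt with rfl | hi
  · rw [chainGrad_apply_of_mem_prefixSpace w hx le_rfl, hw, zero_mul, neg_zero]
  · exact chainGrad_mem_prefixSpace_succ w hx i hi

end PrefixSpace

/-- Bounds `before` and `after` on the length of the prefix of coordinates revealed before and after
the call `(r, k, m)`, when the oracles draw the data `z`. -/
structure ProgressBound {M K R T : ℕ} (O : Oracle M T) (z : Fin R × Fin K × Fin M → O.Z)
    (before after : Fin R → Fin K → Fin M → ℕ) : Prop where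
  answer : ∀ r k m, ∀ x ∈ prefixSpace T (before r k m),
    O.g (z (r, k, m)) x ∈ prefixSpace T (after r k m)
  round : ∀ r' r k' k m' m, r' < r → after r' k' m' ≤ before r k m
  call : ∀ r k' k m, k' < k → after r k' m ≤ before r k m

namespace ProgressBound

variable {M K R T : ℕ} {O : Oracle M T} {z : Fin R × Fin K × Fin M → O.Z}
  {before after : Fin R → Fin K → Fin M → ℕ}

theorem answerSupp_transcript_subset (h : ProgressBound O z before after) (A : ZRAlgorithm M K R T)
    (r : Fin R) (k : Fin K) (m : Fin M) :
    answerSupp (transcript A O z r k m) ⊆ {i | (i : ℕ) < after r k m} := by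
  induction r using WellFoundedLT.induction generalizing k m with
  | ind r ihr =>
    induction k using WellFoundedLT.induction with
    | ind k ihk =>
      rw [transcript]
      refine Set.iUnion_subset fun j => mem_prefixSpace_iff_supp_subset.1 (h.answer r k m _
        (mem_prefixSpace_iff_supp_subset.2 ((A.supp_query _ _ _ _ _ j).trans
          (Set.union_subset (Set.iUnion_subset fun l => ?_)
            (Set.iUnion_subset fun s => Set.iUnion_subset fun l =>
              Set.iUnion_subset fun n => ?_)))))
      · have hl : (⟨l, l.isLt.trans k.isLt⟩ : Fin K) < k := l.isLt
        exact (ihk _ hl).trans fun i hi => hi.trans_le (h.call _ _ _ _ hl)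
      · have hs : (⟨s, s.isLt.trans r.isLt⟩ : Fin R) < r := s.isLt
        exact (ihr _ hs l n).trans fun i hi => hi.trans_le (h.round _ _ _ _ _ _ hs)

theorem output_mem (h : ProgressBound O z before after) (A : ZRAlgorithm M K R T) {N : ℕ}
    (hN : ∀ r k m, after r k m ≤ N) : A.output (transcript A O z) ∈ prefixSpace T N :=
  mem_prefixSpace_iff_supp_subset.2 <| (A.supp_output _).trans <|
    Set.iUnion_subset fun r => Set.iUnion_subset fun k => Set.iUnion_subset fun m =>
      (h.answerSupp_transcript_subset A r k m).trans fun _ hi => hi.trans_le (hN r k m)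

end ProgressBound

/-! ### Exact oracles -/

/-- The noiseless oracles of the objectives `F`: the datum of machine `m` is its name. -/
noncomputable abbrev exactOracle {M d : ℕ} (F : Fin M → Vec d → ℝ) : Oracle M d where
  Z := Fin M
  D := fun m => Measure.dirac m
  s := F
  g := fun m => gradient (F m)

section ExactOracle

variable {M K R d : ℕ} {F : Fin M → Vec d → ℝ} {H Δ τ ζ : ℝ}

theorem continuous_of_norm_sub_le {E E' : Type*} [SeminormedAddCommGroup E]
    [SeminormedAddCommGroup E'] {f : E → E'} {C : ℝ} (h : ∀ x y, ‖f x - f y‖ ≤ C * ‖x - y‖) :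
    Continuous f :=
  (LipschitzWith.of_dist_le' fun x y => by simpa only [dist_eq_norm] using h x y).continuous

theorem InClass.exactOracle_isFor (h : InClass F H Δ τ ζ) (σ : ℝ) :
    (exactOracle F).IsFor F H σ where
  measurable_s := measurable_from_prod_countable_right fun m =>
    (h.differentiable m).continuous.measurable
  measurable_g := measurable_from_prod_countable_right fun m =>
    (continuous_of_norm_sub_le (h.smooth m)).measurable
  integrable_s := fun _ _ => Integrable.of_finite
  integrable_g := fun _ _ => Integrable.of_finite
  mean_s := fun m x => integral_dirac (fun z => F z x) m
  mean_g := fun m x => integral_dirac (fun z => gradient (F z) x) m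
  variance := fun m x => by
    simp only [lintegral_dirac (a := m) fun z => ‖gradient (F z) x - gradient (F m) x‖ₑ ^ 2]
    simp
  mean_smooth := fun m x y => by
    simp only [lintegral_dirac (a := m) fun z => ‖gradient (F z) x - gradient (F z) y‖ₑ]
    rw [← ofReal_norm]
    exact ENNReal.ofReal_le_ofReal (h.smooth m x y)

theorem pi_dirac {ι : Type*} [Fintype ι] {X : ι → Type*} [∀ i, MeasurableSpace (X i)]
    (a : ∀ i, X i) : (Measure.pi fun i => Measure.dirac (a i)) = Measure.dirac a := by
  classical
  refine Measure.pi_eq fun s hs => ?_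
  rw [Measure.dirac_apply' _ (.univ_pi hs)]
  simp only [Measure.dirac_apply' _ (hs _)]
  by_cases ha : a ∈ Set.univ.pi s
  · rw [Set.indicator_of_mem ha]
    exact (Finset.prod_eq_one fun i _ => Set.indicator_of_mem (ha i trivial) _).symm
  · obtain ⟨i, hi⟩ : ∃ i, a i ∉ s i := by simpa using ha
    rw [Set.indicator_of_notMem ha]
    exact (Finset.prod_eq_zero (Finset.mem_univ i) (Set.indicator_of_notMem hi _)).symm

theorem expectedError_exactOracle (A : ZRAlgorithm M K R d) (F : Fin M → Vec d → ℝ) :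
    expectedError A F (exactOracle F) =
      ‖gradient (avg F) (A.output (transcript A (exactOracle F) fun i => i.2.2))‖ₑ ^ 2 := by
  rw [expectedError, show (Measure.pi fun i : Fin R × Fin K × Fin M => (exactOracle F).D i.2.2) =
    Measure.dirac fun i => i.2.2 from pi_dirac _]
  exact lintegral_dirac _ _

end ExactOracle

/-! ### Masked oracles -/

open ProbabilityTheory (bernoulliMeasure integral_bernoulliMeasure)

/-- The multiplier of the hidden part of the gradient that a masked oracle subtracts: the hidden
part is cancelled on failure, and on success, which has probability `p`, overcompensated to make
the multiplier centred. -/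
noncomputable def mask (p : unitInterval) (z : Bool) : ℝ := if z then 1 - (p : ℝ)⁻¹ else 1

/-- The oracle, the same on every machine, that hides the part `B` of the gradient of `F` except
with probability `p`. -/
noncomputable abbrev maskedOracle (M : ℕ) {d : ℕ} (F : Vec d → ℝ) (B : Vec d → Vec d)
    (p : unitInterval) : Oracle M d where
  Z := Bool
  D := fun _ => bernoulliMeasure true false p
  s := fun _ => F
  g := fun z x => gradient F x - mask p z • B x

section Mask

variable {p : unitInterval}

theorem integral_mask (hp : 0 < (p : ℝ)) : ∫ z, mask p z ∂(bernoulliMeasure true false p) = 0 := by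
  rw [integral_bernoulliMeasure]
  simp only [mask, if_true, Bool.false_eq_true, if_false, smul_eq_mul]
  field_simp
  ring

theorem integral_abs_mask_le (hp : 0 < (p : ℝ)) :
    ∫ z, |mask p z| ∂(bernoulliMeasure true false p) ≤ 2 := by
  have habs : |1 - (p : ℝ)⁻¹| = (p : ℝ)⁻¹ - 1 := by
    rw [abs_sub_comm, abs_of_nonneg (sub_nonneg.2 ((one_le_inv₀ hp).2 p.2.2))]
  rw [integral_bernoulliMeasure]
  simp only [mask, if_true, Bool.false_eq_true, if_false, smul_eq_mul, habs, abs_one]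
  rw [mul_sub, mul_inv_cancel₀ hp.ne']
  linarith

theorem integral_sq_mask_le (hp : 0 < (p : ℝ)) :
    ∫ z, mask p z ^ 2 ∂(bernoulliMeasure true false p) ≤ (p : ℝ)⁻¹ := by
  rw [integral_bernoulliMeasure]
  simp only [mask, if_true, Bool.false_eq_true, if_false, smul_eq_mul]
  have hvar : (p : ℝ) * (1 - (p : ℝ)⁻¹) ^ 2 + (1 - p) * 1 ^ 2 = (p : ℝ)⁻¹ - 1 := by
    field_simp
    ring
  linarith

end Mask

section MaskedOracle

variable {M d : ℕ} {F : Vec d → ℝ} {B : Vec d → Vec d} {p : unitInterval}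

theorem lintegral_sq_maskedOracle_sub_gradient_le (hp : 0 < (p : ℝ)) {σ : ℝ} {x : Vec d}
    (hσ : ‖B x‖ ^ 2 ≤ p * σ ^ 2) :
    ∫⁻ z, ‖gradient F x - mask p z • B x - gradient F x‖ₑ ^ 2 ∂(bernoulliMeasure true false p)
      ≤ ENNReal.ofReal (σ ^ 2) := by
  have hsq (z : Bool) : ‖gradient F x - mask p z • B x - gradient F x‖ₑ ^ 2
      = ENNReal.ofReal (mask p z ^ 2 * ‖B x‖ ^ 2) := by
    rw [sub_sub_cancel_left, enorm_neg, ← ofReal_norm, ← ENNReal.ofReal_pow (norm_nonneg _),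
      norm_smul, mul_pow, Real.norm_eq_abs, sq_abs]
  simp only [hsq]
  rw [← ofReal_integral_eq_lintegral_ofReal .of_finite (.of_forall fun _ => by positivity),
    integral_mul_const]
  refine ENNReal.ofReal_le_ofReal ?_
  calc _ ≤ (p : ℝ)⁻¹ * (p * σ ^ 2) := by
        gcongr
        exact integral_sq_mask_le hp
    _ = σ ^ 2 := inv_mul_cancel_left₀ hp.ne' _

theorem lintegral_maskedOracle_sub_le (hp : 0 < (p : ℝ)) {ℓ₁ ℓ₂ H : ℝ} (hH : ℓ₁ + 2 * ℓ₂ ≤ H)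
    {x y : Vec d} (hF : ‖gradient F x - gradient F y‖ ≤ ℓ₁ * ‖x - y‖)
    (hB : ‖B x - B y‖ ≤ ℓ₂ * ‖x - y‖) :
    ∫⁻ z, ‖gradient F x - mask p z • B x - (gradient F y - mask p z • B y)‖ₑ
      ∂(bernoulliMeasure true false p) ≤ ENNReal.ofReal (H * ‖x - y‖) := by
  have htriangle (z : Bool) :
      ‖gradient F x - mask p z • B x - (gradient F y - mask p z • B y)‖
        ≤ ‖gradient F x - gradient F y‖ + |mask p z| * ‖B x - B y‖ := by
    rw [show gradient F x - mask p z • B x - (gradient F y - mask p z • B y)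
      = (gradient F x - gradient F y) - mask p z • (B x - B y) by module]
    exact (norm_sub_le _ _).trans_eq (by rw [norm_smul, Real.norm_eq_abs])
  rw [← ofReal_integral_norm_eq_lintegral_enorm .of_finite]
  refine ENNReal.ofReal_le_ofReal ?_
  calc _ ≤ ∫ z, (‖gradient F x - gradient F y‖ + |mask p z| * ‖B x - B y‖)
          ∂(bernoulliMeasure true false p) :=
        integral_mono .of_finite .of_finite htriangle
    _ = ‖gradient F x - gradient F y‖
          + (∫ z, |mask p z| ∂(bernoulliMeasure true false p)) * ‖B x - B y‖ := by
        rw [integral_add .of_finite .of_finite, integral_mul_const]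
        simp
    _ ≤ ℓ₁ * ‖x - y‖ + 2 * (ℓ₂ * ‖x - y‖) := by
        gcongr
        exact integral_abs_mask_le hp
    _ = (ℓ₁ + 2 * ℓ₂) * ‖x - y‖ := by ring
    _ ≤ H * ‖x - y‖ := by gcongr

theorem maskedOracle_isFor (hp : 0 < (p : ℝ)) {ℓ₁ ℓ₂ H σ : ℝ} (hFcont : Continuous F)
    (hF : ∀ x y, ‖gradient F x - gradient F y‖ ≤ ℓ₁ * ‖x - y‖)
    (hB : ∀ x y, ‖B x - B y‖ ≤ ℓ₂ * ‖x - y‖) (hH : ℓ₁ + 2 * ℓ₂ ≤ H)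
    (hσ : ∀ x, ‖B x‖ ^ 2 ≤ p * σ ^ 2) : (maskedOracle M F B p).IsFor (fun _ => F) H σ where
  measurable_s := hFcont.measurable.comp measurable_snd
  measurable_g := ((continuous_of_norm_sub_le hF).measurable.comp measurable_snd).sub
    (((measurable_of_countable (mask p)).comp measurable_fst).smul
      ((continuous_of_norm_sub_le hB).measurable.comp measurable_snd))
  integrable_s _ _ := .of_finite
  integrable_g _ _ := .of_finite
  mean_s _ x := by simp
  mean_g _ x := by
    change ∫ z, (gradient F x - mask p z • B x) ∂(bernoulliMeasure true false p) = _
    rw [integral_sub .of_finite .of_finite, integral_smul_const, integral_mask hp]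
    simp
  variance _ x := lintegral_sq_maskedOracle_sub_gradient_le hp (hσ x)
  mean_smooth _ x y := lintegral_maskedOracle_sub_le hp hH (hF x y) (hB x y)

end MaskedOracle

section Successes

open Finset

theorem integral_card_successes {ι : Type*} [Fintype ι] (p : unitInterval) :
    ∫ z, (#{i | z i = true} : ℝ) ∂(Measure.pi fun _ : ι => bernoulliMeasure true false p)
      = Fintype.card ι * p := by
  simp only [card_filter, Nat.cast_sum]
  rw [integral_finsetSum _ fun _ _ => .of_finite]
  have hcoord (i : ι) : ∫ z, ((if z i = true then 1 else 0 : ℕ) : ℝ)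
      ∂(Measure.pi fun _ : ι => bernoulliMeasure true false p) = p := by
    rw [integral_comp_eval (μ := fun _ : ι => bernoulliMeasure true false p)
      (f := fun b : Bool => ((if b = true then 1 else 0 : ℕ) : ℝ))
      (measurable_of_countable _).aestronglyMeasurable, integral_bernoulliMeasure]
    simp
  rw [sum_congr rfl fun i _ => hcoord i]
  simp

theorem half_le_measureReal_card_successes_lt {ι : Type*} [Fintype ι] {p : unitInterval} {N : ℕ}
    (hN : 0 < N) (hp : 2 * (Fintype.card ι * (p : ℝ)) ≤ N) :
    1 / 2 ≤ (Measure.pi fun _ : ι => bernoulliMeasure true false p).real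
      {z | #{i | z i = true} < N} := by
  have hmarkov := mul_meas_ge_le_integral_of_nonneg
    (μ := Measure.pi fun _ : ι => bernoulliMeasure true false p)
    (f := fun z => (#{i | z i = true} : ℝ)) (.of_forall fun _ => Nat.cast_nonneg _) .of_finite N
  have hcompl : {z : ι → Bool | (N : ℝ) ≤ #{i | z i = true}} = {z | #{i | z i = true} < N}ᶜ := by
    ext z
    simp
  rw [integral_card_successes, hcompl, probReal_compl_eq_one_sub .of_discrete] at hmarkov
  have hN' : (0 : ℝ) < N := Nat.cast_pos.2 hN
  nlinarith

theorem le_expectedError_maskedOracle {M K R d : ℕ} {F : Vec d → ℝ} {B : Vec d → Vec d}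
    {p : unitInterval} {f : Fin M → Vec d → ℝ} {e : ℝ} {N : ℕ} (A : ZRAlgorithm M K R d)
    (hN : 0 < N) (hp : 2 * (R * (K * M) * (p : ℝ)) ≤ N)
    (h : ∀ z : Fin R × Fin K × Fin M → Bool, #{i | z i = true} < N →
      e ≤ ‖gradient (avg f) (A.output (transcript A (maskedOracle M F B p) z))‖ ^ 2) :
    ENNReal.ofReal (e / 2) ≤ expectedError A f (maskedOracle M F B p) := by
  set μ := Measure.pi fun _ : Fin R × Fin K × Fin M => bernoulliMeasure true false p
  set S := {z : Fin R × Fin K × Fin M → Bool | #{i | z i = true} < N}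
  have hS : 1 / 2 ≤ μ.real S := half_le_measureReal_card_successes_lt hN (by simpa using hp)
  calc ENNReal.ofReal (e / 2) = ENNReal.ofReal e * ENNReal.ofReal (1 / 2) := by
        rw [← ENNReal.ofReal_mul' (by norm_num)]
        ring_nf
    _ ≤ ENNReal.ofReal e * μ S := by
        rw [← ofReal_measureReal]
        gcongr
    _ = ∫⁻ _ in S, ENNReal.ofReal e ∂μ := (setLIntegral_const _ _).symm
    _ ≤ ∫⁻ z in S, ‖gradient (avg f)
          (A.output (transcript A (maskedOracle M F B p) z))‖ₑ ^ 2 ∂μ :=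
        setLIntegral_mono' .of_discrete fun z hz => by
          rw [← ofReal_norm, ← ENNReal.ofReal_pow (norm_nonneg _)]
          exact ENNReal.ofReal_le_ofReal (h z hz)
    _ ≤ expectedError A f (maskedOracle M F B p) := setLIntegral_le_lintegral _ _

end Successes

/-! ### The hidden part of the gradient -/

section Hidden

variable {T : ℕ}

theorem norm_sq_le_ncard_supp_mul {u : Vec T} {C : ℝ} (h : ∀ i, |u i| ≤ C) :
    ‖u‖ ^ 2 ≤ (supp u).ncard * C ^ 2 := by
  classical
  rw [EuclideanSpace.real_norm_sq_eq, Set.ncard_eq_toFinset_card', ← nsmul_eq_mul]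
  calc ∑ i, u i ^ 2 = ∑ i ∈ (supp u).toFinset, u i ^ 2 :=
        (Finset.sum_subset (Finset.subset_univ _) fun i _ hi => by
          have hui : u i = 0 := by
            by_contra hne
            exact hi (Set.mem_toFinset.2 hne)
          rw [hui]
          norm_num).symm
    _ ≤ (supp u).toFinset.card • C ^ 2 := Finset.sum_le_card_nsmul _ _ _ fun i _ =>
        (sq_abs (u i)).symm.trans_le (pow_le_pow_left₀ (abs_nonneg _) (h i) 2)

theorem supp_sub_subset (u v : Vec T) : supp (u - v) ⊆ supp u ∪ supp v := by
  intro i hi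
  by_contra hmem
  simp only [supp, Set.mem_union, Set.mem_ofPred_eq, not_or, not_not] at hmem hi
  simp [hmem] at hi

theorem abs_apply_le_infDist_prefixSpace (x : Vec T) {c : ℕ} {j : Fin T} (hj : c ≤ j) :
    |x j| ≤ Metric.infDist x (prefixSpace T c) := by
  refine (Metric.le_infDist ⟨0, (prefixSpace T c).zero_mem⟩).2 fun y hy => ?_
  have hyj : y j = 0 := hy j hj
  rw [dist_eq_norm]
  simpa [hyj] using PiLp.norm_apply_le (x - y) j

/-- The part of the gradient of the chain that would reveal the next coordinate when the coordinates
revealed so far form a prefix. Entry `i` is switched off away from `prefixSpace T i`, which leaves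
at most one nonzero entry and hence keeps the norm bounded independently of the dimension. -/
noncomputable def hidden (x : Vec T) : Vec T :=
  WithLp.toLp 2 fun i => -max 0 (gate (pad x i) - 2 * Metric.infDist x (prefixSpace T i))

theorem hidden_apply (x : Vec T) (i : Fin T) :
    hidden x i = -max 0 (gate (pad x i) - 2 * Metric.infDist x (prefixSpace T i)) := rfl

theorem hidden_apply_of_mem_prefixSpace {x : Vec T} {i : Fin T} (hx : x ∈ prefixSpace T i) :
    hidden x i = -gate (pad x i) := by
  rw [hidden_apply, Metric.infDist_zero_of_mem hx, mul_zero, sub_zero,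
    max_eq_right (gate_nonneg _)]

theorem hidden_apply_of_gate_eq_zero {x : Vec T} {i : Fin T} (h : gate (pad x i) = 0) :
    hidden x i = 0 := by
  rw [hidden_apply, h, zero_sub,
    max_eq_left (neg_nonpos.2 (mul_nonneg zero_le_two Metric.infDist_nonneg)), neg_zero]

theorem hidden_mem_prefixSpace_succ {c : ℕ} {x : Vec T} (hx : x ∈ prefixSpace T c) :
    hidden x ∈ prefixSpace T (c + 1) :=
  fun _ hi => hidden_apply_of_gate_eq_zero (gate_pad_of_mem_prefixSpace hx hi)

theorem chainGrad_sub_hidden_mem_prefixSpace {c : ℕ} {x : Vec T} (hx : x ∈ prefixSpace T c) :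
    chainGrad 1 x - hidden x ∈ prefixSpace T c := fun i hi => by
  rcases hi.eq_or_lt with rfl | hi
  · rw [PiLp.sub_apply, chainGrad_apply_of_mem_prefixSpace 1 hx le_rfl,
      hidden_apply_of_mem_prefixSpace hx, Pi.one_apply, one_mul, sub_self]
  · exact (prefixSpace T (c + 1)).sub_mem (chainGrad_mem_prefixSpace_succ 1 hx)
      (hidden_mem_prefixSpace_succ hx) i hi

theorem hidden_apply_eq_zero_of_lt {x : Vec T} {i j : Fin T} (hij : i < j) (hj : hidden x j ≠ 0) :
    hidden x i = 0 := by
  obtain ⟨k, hk⟩ : ∃ k : Fin T, (j : ℕ) = k + 1 := by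
    rw [Fin.lt_def] at hij
    exact ⟨⟨j - 1, by omega⟩, by simp only; omega⟩
  have hxk : 1 / 2 < |x k| := by
    by_contra! hxk
    exact hj (hidden_apply_of_gate_eq_zero (gate_eq_zero (by rwa [hk, pad_fin_succ])))
  have hfar : |x k| ≤ Metric.infDist x (prefixSpace T i) :=
    abs_apply_le_infDist_prefixSpace x (by have : (i : ℕ) < j := hij; omega)
  rw [hidden_apply, max_eq_left (by linarith [gate_le_one (pad x i)]), neg_zero]

theorem subsingleton_supp_hidden (x : Vec T) : (supp (hidden x)).Subsingleton := by
  intro i hi j hj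
  by_contra hne
  rcases lt_or_gt_of_ne hne with hlt | hlt
  · exact hi (hidden_apply_eq_zero_of_lt hlt hj)
  · exact hj (hidden_apply_eq_zero_of_lt hlt hi)

theorem ncard_supp_hidden_le_one (x : Vec T) : (supp (hidden x)).ncard ≤ 1 :=
  Set.ncard_le_one_iff_subsingleton.2 (subsingleton_supp_hidden x)

theorem norm_sq_hidden_le_one (x : Vec T) : ‖hidden x‖ ^ 2 ≤ 1 := by
  have happly (i : Fin T) : |hidden x i| ≤ 1 := by
    rw [hidden_apply, abs_neg, abs_of_nonneg (le_max_left _ _), max_le_iff]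
    have hdist : 0 ≤ Metric.infDist x (prefixSpace T i) := Metric.infDist_nonneg
    exact ⟨zero_le_one, by linarith [gate_le_one (pad x i)]⟩
  calc ‖hidden x‖ ^ 2 ≤ (supp (hidden x)).ncard * 1 ^ 2 := norm_sq_le_ncard_supp_mul happly
    _ ≤ 1 := by
        rw [one_pow, mul_one]
        exact_mod_cast ncard_supp_hidden_le_one x

theorem abs_hidden_apply_sub_le (x y : Vec T) (i : Fin T) :
    |(hidden x - hidden y) i| ≤ 3 * stepBound * ‖x - y‖ := by
  have hpad : |pad x i - pad y i| ≤ ‖x - y‖ := by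
    rw [pad_sub_pad]
    exact abs_le_of_sq_le_sq (by simpa using sum_sq_padDeriv_le {(i : ℕ)} (x - y)) (norm_nonneg _)
  have hgate := abs_gate_sub_le (pad x i) (pad y i)
  have hdist : |Metric.infDist x (prefixSpace T i) - Metric.infDist y (prefixSpace T i)|
      ≤ ‖x - y‖ := by
    rw [← dist_eq_norm, ← Real.dist_eq]
    exact (Metric.lipschitz_infDist_pt _).dist_le_mul x y |>.trans_eq (one_mul _)
  calc |(hidden x - hidden y) i|
      ≤ |(gate (pad x i) - 2 * Metric.infDist x (prefixSpace T i))
          - (gate (pad y i) - 2 * Metric.infDist y (prefixSpace T i))| := by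
        rw [PiLp.sub_apply, hidden_apply, hidden_apply, neg_sub_neg, abs_sub_comm]
        exact abs_max_sub_max_le_max _ _ _ _ |>.trans (by simp)
    _ ≤ |gate (pad x i) - gate (pad y i)|
          + 2 * |Metric.infDist x (prefixSpace T i) - Metric.infDist y (prefixSpace T i)| := by
        rw [sub_sub_sub_comm, ← mul_sub, ← abs_two (α := ℝ), ← abs_mul, abs_two]
        exact abs_sub _ _
    _ ≤ stepBound * ‖x - y‖ + 2 * ‖x - y‖ := by
        gcongr
        exact hgate.trans (mul_le_mul_of_nonneg_left hpad stepBound_pos.le)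
    _ ≤ 3 * stepBound * ‖x - y‖ := by
        linarith [mul_le_mul_of_nonneg_right one_le_stepBound (norm_nonneg (x - y))]

theorem norm_hidden_sub_le (x y : Vec T) : ‖hidden x - hidden y‖ ≤ 5 * stepBound * ‖x - y‖ := by
  have hL := stepBound_pos
  refine le_of_sq_le_sq ?_ (by positivity)
  have hcard : (supp (hidden x - hidden y)).ncard ≤ 2 :=
    (Set.ncard_le_ncard (supp_sub_subset _ _)).trans <| (Set.ncard_union_le _ _).trans <|
      add_le_add (ncard_supp_hidden_le_one x) (ncard_supp_hidden_le_one y)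
  calc ‖hidden x - hidden y‖ ^ 2
      ≤ (supp (hidden x - hidden y)).ncard * (3 * stepBound * ‖x - y‖) ^ 2 :=
        norm_sq_le_ncard_supp_mul (abs_hidden_apply_sub_le x y)
    _ ≤ 2 * (3 * stepBound * ‖x - y‖) ^ 2 := by
        gcongr
        exact_mod_cast hcard
    _ ≤ (5 * stepBound * ‖x - y‖) ^ 2 := by
        nlinarith [sq_nonneg (stepBound * ‖x - y‖)]

end Hidden

/-! ### Scaled chains -/

theorem hasGradientAt_const_mul_comp_smul {E : Type*} [NormedAddCommGroup E] [InnerProductSpace ℝ E]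
    [CompleteSpace E] {f : E → ℝ} {g x : E} (a : ℝ) {μ : ℝ} (h : HasGradientAt f g (μ • x)) :
    HasGradientAt (fun y => a * f (μ • y)) ((a * μ) • g) x := by
  rw [hasGradientAt_iff_hasFDerivAt] at h ⊢
  refine ((h.comp x ((hasFDerivAt_id x).const_smul μ)).const_mul a).congr_fderiv ?_
  ext v
  simp [mul_assoc]

theorem norm_smul_comp_smul_sub_le {E E' : Type*} [NormedAddCommGroup E] [NormedSpace ℝ E]
    [NormedAddCommGroup E'] [NormedSpace ℝ E'] {g : E → E'} {a μ ℓ : ℝ} (ha : 0 ≤ a) (hμ : 0 ≤ μ)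
    (hg : ∀ x y, ‖g x - g y‖ ≤ ℓ * ‖x - y‖) (x y : E) :
    ‖(a * μ) • g (μ • x) - (a * μ) • g (μ • y)‖ ≤ a * μ ^ 2 * ℓ * ‖x - y‖ :=
  calc ‖(a * μ) • g (μ • x) - (a * μ) • g (μ • y)‖ = a * μ * ‖g (μ • x) - g (μ • y)‖ := by
        rw [← smul_sub, norm_smul, Real.norm_of_nonneg (mul_nonneg ha hμ)]
    _ ≤ a * μ * (ℓ * ‖μ • x - μ • y‖) := by
        gcongr
        exact hg _ _
    _ = a * μ ^ 2 * ℓ * ‖x - y‖ := by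
        rw [← smul_sub, norm_smul, Real.norm_of_nonneg hμ]
        ring

section ScaledChain

variable {M T : ℕ} {a μ : ℝ}

/-- The hard objective: `chain w` with values scaled by `a` and arguments scaled by `μ`. -/
noncomputable def scaledChain (a μ : ℝ) (w : ℕ → ℝ) (x : Vec T) : ℝ := a * chain w (μ • x)

theorem hasGradientAt_scaledChain (a μ : ℝ) (w : ℕ → ℝ) (x : Vec T) :
    HasGradientAt (scaledChain a μ w) ((a * μ) • chainGrad w (μ • x)) x :=
  hasGradientAt_const_mul_comp_smul a (hasGradientAt_chain w (μ • x))

theorem gradient_scaledChain (a μ : ℝ) (w : ℕ → ℝ) :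
    gradient (scaledChain a μ w) = fun x : Vec T => (a * μ) • chainGrad w (μ • x) :=
  funext fun x => (hasGradientAt_scaledChain a μ w x).gradient

theorem differentiable_scaledChain (a μ : ℝ) (w : ℕ → ℝ) :
    Differentiable ℝ (scaledChain a μ w : Vec T → ℝ) :=
  fun x => (hasGradientAt_scaledChain a μ w x).differentiableAt

theorem differentiable_gradient_scaledChain (a μ : ℝ) (w : ℕ → ℝ) :
    Differentiable ℝ (gradient (scaledChain a μ w : Vec T → ℝ)) := by
  rw [gradient_scaledChain]
  exact ((differentiable_chainGrad w).comp (differentiable_id.const_smul μ)).const_smul (a * μ)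

theorem gradient_scaledChain_sub (a μ : ℝ) (w w' : ℕ → ℝ) (x : Vec T) :
    gradient (scaledChain a μ w) x - gradient (scaledChain a μ w') x
      = gradient (scaledChain a μ (w - w')) x := by
  simp only [gradient_scaledChain]
  rw [← smul_sub, chainGrad_sub]

theorem norm_gradient_scaledChain_sub_le (ha : 0 ≤ a) (hμ : 0 ≤ μ) {w : ℕ → ℝ} {B : ℝ}
    (hB : ∀ k, |w k| ≤ B) (x y : Vec T) :
    ‖gradient (scaledChain a μ w) x - gradient (scaledChain a μ w) y‖
      ≤ a * μ ^ 2 * (32 * stepBound * B) * ‖x - y‖ := by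
  simp only [gradient_scaledChain]
  exact norm_smul_comp_smul_sub_le ha hμ (norm_chainGrad_sub_le hB) x y

theorem norm_sq_gradient_scaledChain_le {w : ℕ → ℝ} {B : ℝ} (hB : ∀ k, |w k| ≤ B) (x : Vec T) :
    ‖gradient (scaledChain a μ w) x‖ ^ 2 ≤ (a * μ) ^ 2 * ((9 * stepBound * B) ^ 2 * T) := by
  simp only [gradient_scaledChain]
  rw [norm_smul, mul_pow, Real.norm_eq_abs, sq_abs]
  gcongr
  exact norm_sq_chainGrad_le hB _

theorem scaledChain_sub_le (ha : 0 ≤ a) {w : ℕ → ℝ} (hw : ∀ k, |w k| ≤ 1) (x y : Vec T) :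
    scaledChain a μ w x - scaledChain a μ w y ≤ 8 * (T + 1) * a := by
  have hx := abs_le.1 (abs_chain_le hw (μ • x))
  have hy := abs_le.1 (abs_chain_le hw (μ • y))
  calc scaledChain a μ w x - scaledChain a μ w y
      = a * (chain w (μ • x) - chain w (μ • y)) := (mul_sub _ _ _).symm
    _ ≤ a * (8 * (T + 1)) := by
        gcongr
        linarith
    _ = 8 * (T + 1) * a := mul_comm _ _

theorem scaledChain_inClass {H Δ τ ζ ρ : ℝ} {w : Fin M → ℕ → ℝ} (hM : 0 < M) (ha : 0 ≤ a)
    (hμ : 0 ≤ μ) (hw : ∀ m k, |w m k| ≤ 1) (hρ : ∀ m n k, |(w m - w n) k| ≤ ρ)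
    (hH : a * μ ^ 2 * (32 * stepBound * 1) ≤ H) (hΔ : 8 * (T + 1) * a ≤ Δ)
    (hτ : a * μ ^ 2 * (32 * stepBound * ρ) ≤ τ) (hHζ : 0 ≤ H * ζ)
    (hζ : (a * μ) ^ 2 * ((9 * stepBound * ρ) ^ 2 * T) ≤ (H * ζ) ^ 2) :
    InClass (fun m => (scaledChain a μ (w m) : Vec T → ℝ)) H Δ τ ζ where
  differentiable m := differentiable_scaledChain a μ (w m)
  twice_differentiable m := differentiable_gradient_scaledChain a μ (w m)
  smooth m x y := (norm_gradient_scaledChain_sub_le ha hμ (hw m) x y).trans (by gcongr)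
  subopt x := by
    rw [avg, avg, ← sub_div, ← Finset.sum_sub_distrib, div_le_iff₀ (Nat.cast_pos.2 hM)]
    calc ∑ m, (scaledChain a μ (w m) 0 - scaledChain a μ (w m) x) ≤ ∑ _m : Fin M, Δ :=
          Finset.sum_le_sum fun m _ => (scaledChain_sub_le ha (hw m) 0 x).trans hΔ
      _ = Δ * M := by simp [mul_comm]
  second_order m n x := by
    have hρ0 : 0 ≤ ρ := (abs_nonneg _).trans (hρ m n 0)
    have hL := stepBound_pos
    rw [← fderiv_fun_sub (differentiable_gradient_scaledChain a μ (w m) x)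
      (differentiable_gradient_scaledChain a μ (w n) x)]
    simp only [gradient_scaledChain_sub]
    exact norm_fderiv_le_of_lip' ℝ (le_trans (by positivity) hτ) (.of_forall fun y =>
      (norm_gradient_scaledChain_sub_le ha hμ (hρ m n) y x).trans (by gcongr))
  first_order m n x := by
    rw [gradient_scaledChain_sub]
    exact le_of_sq_le_sq ((norm_sq_gradient_scaledChain_le (hρ m n) x).trans hζ) hHζ

theorem sq_le_norm_sq_gradient_avg_scaledChain {w : Fin M → ℕ → ℝ} {ω : ℝ} (hω : 0 ≤ ω)
    (hw : ∀ k, ω ≤ (M : ℝ)⁻¹ * ∑ m, w m k) {N : ℕ} (hN : N < T) {x : Vec T}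
    (hx : x ∈ prefixSpace T N) :
    (a * μ) ^ 2 * (ω / 2) ^ 2
      ≤ ‖gradient (avg fun m => (scaledChain a μ (w m) : Vec T → ℝ)) x‖ ^ 2 := by
  have hgrad := (hasGradientAt_avg fun m => hasGradientAt_scaledChain a μ (w m) x).gradient
  rw [← Finset.smul_sum, smul_comm, inv_smul_sum_chainGrad] at hgrad
  rw [hgrad, norm_smul, mul_pow ‖_‖, Real.norm_eq_abs, sq_abs]
  gcongr
  exact half_le_norm_chainGrad hω hw (i₀ := ⟨N, hN⟩)
    ((prefixSpace T N).smul_mem μ hx ⟨N, hN⟩ le_rfl)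

theorem exists_scale (T : ℕ) {Δ h : ℝ} (hΔ : 0 ≤ Δ) (hh : 0 ≤ h) :
    ∃ a μ : ℝ, 0 ≤ a ∧ 0 ≤ μ ∧ 8 * (T + 1) * a ≤ Δ ∧ a * μ ^ 2 * (64 * stepBound ^ 2) ≤ h ∧
      (a * μ) ^ 2 = Δ * h / (512 * stepBound ^ 2 * (T + 1)) := by
  have hL := stepBound_pos
  refine ⟨Δ / (8 * (T + 1)), √(h / (64 * stepBound ^ 2) / (Δ / (8 * (T + 1)))), by positivity,
    by positivity, by rw [mul_div_cancel₀]; positivity, ?_, ?_⟩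
  · rw [Real.sq_sqrt (by positivity)]
    rcases hΔ.eq_or_lt with rfl | hΔ
    · simpa using hh
    · apply le_of_eq
      field_simp
  · rw [mul_pow, Real.sq_sqrt (by positivity)]
    rcases hΔ.eq_or_lt with rfl | hΔ
    · simp
    · field_simp
      ring

end ScaledChain

/-! ### Lower bounds -/

/-- Some problem of the class, with suitable oracles, inflicts an expected error of at least `e` on
every zero-respecting algorithm. -/
def Forces (M K R : ℕ) (H Δ τ ζ σ e : ℝ) : Prop :=
  ∃ (d : ℕ) (F : Fin M → Vec d → ℝ) (O : Oracle M d), InClass F H Δ τ ζ ∧ O.IsFor F H σ ∧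
    ∀ A : ZRAlgorithm M K R d, ENNReal.ofReal e ≤ expectedError A F O

namespace Forces

variable {M K R : ℕ} {H Δ τ ζ σ e e' : ℝ}

theorem mono (h : Forces M K R H Δ τ ζ σ e) (he : e' ≤ e) : Forces M K R H Δ τ ζ σ e' := by
  obtain ⟨d, F, O, hF, hO, hA⟩ := h
  exact ⟨d, F, O, hF, hO, fun A => (ENNReal.ofReal_le_ofReal he).trans (hA A)⟩

theorem mean (h : Forces M K R H Δ τ ζ σ e) (h' : Forces M K R H Δ τ ζ σ e') :
    Forces M K R H Δ τ ζ σ ((e + e') / 2) := by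
  rcases le_total e e' with hle | hle
  · exact h'.mono (by linarith)
  · exact h.mono (by linarith)

theorem le_minimaxError (h : Forces M K R H Δ τ ζ σ e) :
    ENNReal.ofReal e ≤ minimaxError M K R H Δ τ ζ σ := by
  obtain ⟨d, F, O, hF, hO, hA⟩ := h
  exact le_iInf fun A => (hA (A d)).trans <| le_iSup_of_le d <| le_iSup_of_le F <|
    le_iSup_of_le O <| le_iSup_of_le hF <| le_iSup_of_le hO le_rfl

end Forces

/-- The universal constant with which each term of the lower bound is forced separately. The
heterogeneous instance dictates it: `55296 = 512 * 3 * 6 ^ 2`, where `512` comes from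
`exists_scale`, `3` from `R + 2 ≤ 3 * R` and `6` from the mean link weight `1 / 3`. -/
noncomputable def rateConst : ℝ := 1 / (55296 * stepBound ^ 2)

theorem rateConst_pos : 0 < rateConst := by
  have hL := stepBound_pos
  exact one_div_pos.2 (by positivity)

section Instances

variable {M K R T : ℕ} {H Δ τ ζ σ a μ : ℝ}

theorem forces_of_progressBound {w : Fin M → ℕ → ℝ} {before after : Fin R → Fin K → Fin M → ℕ}
    {ω : ℝ} {N : ℕ} (hF : InClass (fun m => (scaledChain a μ (w m) : Vec T → ℝ)) H Δ τ ζ)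
    (hω : 0 ≤ ω) (hw : ∀ k, ω ≤ (M : ℝ)⁻¹ * ∑ m, w m k)
    (h : ProgressBound (exactOracle fun m => (scaledChain a μ (w m) : Vec T → ℝ))
      (fun i => i.2.2) before after)
    (hafter : ∀ r k m, after r k m ≤ N) (hN : N < T) :
    Forces M K R H Δ τ ζ σ ((a * μ) ^ 2 * (ω / 2) ^ 2) := by
  refine ⟨T, _, exactOracle _, hF, hF.exactOracle_isFor σ, fun A => ?_⟩
  rw [expectedError_exactOracle, ← ofReal_norm, ← ENNReal.ofReal_pow (norm_nonneg _)]
  exact ENNReal.ofReal_le_ofReal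
    (sq_le_norm_sq_gradient_avg_scaledChain hω hw hN (h.output_mem A hafter))

theorem scaledChain_one_inClass (hM : 0 < M) (ha : 0 ≤ a) (hμ : 0 ≤ μ) (hΔ : 8 * (T + 1) * a ≤ Δ)
    (hH : a * μ ^ 2 * (64 * stepBound ^ 2) ≤ H) (hτ : 0 ≤ τ) (hζ : 0 ≤ ζ) :
    InClass (fun _ : Fin M => (scaledChain a μ 1 : Vec T → ℝ)) H Δ τ ζ := by
  have hL := one_le_stepBound
  have hH0 : 0 ≤ H := le_trans (by positivity) hH
  refine scaledChain_inClass (ρ := 0) hM ha hμ (fun _ k => by simp) (fun _ _ k => by simp)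
    (le_trans ?_ hH) hΔ (by simpa using hτ) (by positivity)
    (by simpa using sq_nonneg (H * ζ))
  exact mul_le_mul_of_nonneg_left (by nlinarith) (by positivity)

theorem one_le_mean_one (hM : 0 < M) (k : ℕ) : 1 ≤ (M : ℝ)⁻¹ * ∑ _m : Fin M, (1 : ℕ → ℝ) k := by
  have hMne : (M : ℝ) ≠ 0 := Nat.cast_ne_zero.2 hM.ne'
  simp [hMne]

/-! ### The sequential instance -/

theorem progressBound_sequential (F : Fin M → Vec T → ℝ)
    (hF : ∀ m c, ∀ x ∈ prefixSpace T c, gradient (F m) x ∈ prefixSpace T (c + 1)) :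
    ProgressBound (exactOracle F) (fun i : Fin R × Fin K × Fin M => i.2.2)
      (fun r k _ => r * K + k) (fun r k _ => r * K + k + 1) where
  answer _ _ m x hx := hF m _ x hx
  round r' r k' k _ _ hr := by
    have hlt : (r' : ℕ) * K + k' < (r' + 1) * K := by
      rw [Nat.succ_mul]
      omega
    have hle : ((r' : ℕ) + 1) * K ≤ r * K := Nat.mul_le_mul_right K hr
    omega
  call r k' k _ hk := by
    rw [Fin.lt_def] at hk
    omega

theorem forces_sequential (hM : 0 < M) (hK : 1 ≤ K) (hR : 1 ≤ R) (hH : 0 ≤ H) (hΔ : 0 ≤ Δ)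
    (hτ : 0 ≤ τ) (hζ : 0 ≤ ζ) : Forces M K R H Δ τ ζ σ (rateConst * (Δ * H / (K * R))) := by
  have hL := stepBound_pos
  have hRK : (1 : ℝ) ≤ R * K := by exact_mod_cast Nat.mul_pos hR hK
  obtain ⟨a, μ, ha, hμ, hgap, hsmooth, hsq⟩ := exists_scale (R * K + 1) hΔ hH
  have hF := scaledChain_one_inClass hM ha hμ hgap hsmooth hτ hζ
  have hafter (r : Fin R) (k : Fin K) : (r : ℕ) * K + k + 1 ≤ R * K := by
    have hle : ((r : ℕ) + 1) * K ≤ R * K := Nat.mul_le_mul_right K r.isLt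
    rw [Nat.succ_mul] at hle
    omega
  refine (forces_of_progressBound hF zero_le_one (one_le_mean_one hM)
    (progressBound_sequential _ fun _ c x hx => ?_) (fun r k _ => hafter r k)
    (Nat.lt_succ_self _)).mono ?_
  · rw [gradient_scaledChain]
    exact Submodule.smul_mem _ _
      (chainGrad_mem_prefixSpace_succ 1 ((prefixSpace _ c).smul_mem μ hx))
  · calc rateConst * (Δ * H / (K * R)) = Δ * H / (55296 * stepBound ^ 2 * (R * K)) := by
          rw [rateConst]
          field_simp
      _ ≤ Δ * H / (2048 * stepBound ^ 2 * ((R * K + 1 : ℕ) + 1)) := by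
          refine div_le_div_of_nonneg_left (by positivity) (by positivity) ?_
          push_cast
          nlinarith [sq_nonneg stepBound]
      _ = (a * μ) ^ 2 * (1 / 2) ^ 2 := by
          rw [hsq]
          field_simp
          ring

/-! ### The heterogeneous instance -/

/-- The weights of the heterogeneous instance: machine `m` owns the links of its own parity, so the
link that discloses the next coordinate is invisible to the machines of the other parity. -/
def parityWeight (m : Fin M) (k : ℕ) : ℝ := if k % 2 = m % 2 then 1 else 0

theorem abs_parityWeight_le_one (m : Fin M) (k : ℕ) : |parityWeight m k| ≤ 1 := by
  unfold parityWeight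
  split_ifs <;> simp

theorem abs_parityWeight_sub_le_one (m n : Fin M) (k : ℕ) :
    |(parityWeight m - parityWeight n) k| ≤ 1 := by
  rw [Pi.sub_apply]
  unfold parityWeight
  split_ifs <;> simp

theorem sum_range_ite_mod_two_eq {ρ : ℕ} (hρ : ρ < 2) (M : ℕ) :
    ∑ m ∈ Finset.range M, (if ρ = m % 2 then 1 else 0) = (M + 1 - ρ) / 2 := by
  induction M with
  | zero =>
    rw [Finset.range_zero, Finset.sum_empty]
    omega
  | succ M ih =>
    rw [Finset.sum_range_succ, ih]
    split_ifs <;> omega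

theorem third_le_mean_parityWeight (hM : 2 ≤ M) (k : ℕ) :
    1 / 3 ≤ (M : ℝ)⁻¹ * ∑ m : Fin M, parityWeight m k := by
  have hsum : ∑ m : Fin M, parityWeight m k = ((M + 1 - k % 2) / 2 : ℕ) := by
    rw [← sum_range_ite_mod_two_eq (Nat.mod_lt k two_pos),
      ← Fin.sum_univ_eq_sum_range fun m => if k % 2 = m % 2 then 1 else 0]
    simp [parityWeight]
  have hthird : (M : ℝ) ≤ 3 * ((M + 1 - k % 2) / 2 : ℕ) := by
    exact_mod_cast (by omega : M ≤ 3 * ((M + 1 - k % 2) / 2))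
  rw [hsum, inv_mul_eq_div, le_div_iff₀ (by positivity)]
  linarith

/-- The coordinate that machine `m` can reach in round `r` of the heterogeneous instance. -/
def parityProgress (r : Fin R) (m : Fin M) : ℕ := r + if (r : ℕ) % 2 = m % 2 then 1 else 0

theorem parityProgress_mod_two_ne (r : Fin R) (m : Fin M) :
    parityProgress r m % 2 ≠ (m : ℕ) % 2 := by
  unfold parityProgress
  split_ifs <;> omega

theorem parityProgress_le (r : Fin R) (m : Fin M) : parityProgress r m ≤ r + 1 := by
  unfold parityProgress
  split_ifs <;> omega

theorem le_parityProgress (r : Fin R) (m : Fin M) : (r : ℕ) ≤ parityProgress r m :=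
  Nat.le_add_right _ _

theorem progressBound_parity (F : Fin M → Vec T → ℝ)
    (hF : ∀ (m : Fin M) (c : ℕ), c % 2 ≠ m % 2 →
      ∀ x ∈ prefixSpace T c, gradient (F m) x ∈ prefixSpace T c) :
    ProgressBound (exactOracle F) (fun i : Fin R × Fin K × Fin M => i.2.2)
      (fun r _ m => parityProgress r m) (fun r _ m => parityProgress r m) where
  answer r _ m x hx := hF m _ (parityProgress_mod_two_ne r m) x hx
  round _ _ _ _ _ _ hr := (parityProgress_le _ _).trans (le_trans hr (le_parityProgress _ _))
  call _ _ _ _ _ := le_rfl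

theorem scaledChain_parityWeight_inClass {h : ℝ} (hM : 0 < M) (ha : 0 ≤ a) (hμ : 0 ≤ μ)
    (hΔ : 8 * (T + 1) * a ≤ Δ) (hsmooth : a * μ ^ 2 * (64 * stepBound ^ 2) ≤ h)
    (hsq : (a * μ) ^ 2 = Δ * h / (512 * stepBound ^ 2 * (T + 1))) (hτ : h ≤ τ) (hτH : τ ≤ 2 * H)
    (hHζ : 0 ≤ H * ζ) (hΔh : Δ * h ≤ (H * ζ) ^ 2) :
    InClass (fun m : Fin M => (scaledChain a μ (parityWeight m) : Vec T → ℝ)) H Δ τ ζ := by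
  have hL := one_le_stepBound
  have hlip : a * μ ^ 2 * (32 * stepBound * 1) ≤ h / 2 := by
    have hle : a * μ ^ 2 * (32 * stepBound * 1) ≤ a * μ ^ 2 * (32 * stepBound ^ 2) :=
      mul_le_mul_of_nonneg_left (by nlinarith) (by positivity)
    linarith
  have hh : 0 ≤ h := le_trans (by positivity) hsmooth
  refine scaledChain_inClass (ρ := 1) hM ha hμ abs_parityWeight_le_one abs_parityWeight_sub_le_one
    (by linarith) hΔ (by linarith) hHζ ?_
  calc (a * μ) ^ 2 * ((9 * stepBound * 1) ^ 2 * T) = Δ * h * (81 * T / (512 * (T + 1))) := by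
        rw [hsq]
        field_simp
        ring
    _ ≤ (H * ζ) ^ 2 * 1 := by
        gcongr
        rw [div_le_one (by positivity)]
        linarith [(Nat.cast_nonneg T : (0 : ℝ) ≤ T)]
    _ = (H * ζ) ^ 2 := mul_one _

theorem forces_heterogeneous (hM : 2 ≤ M) (hR : 1 ≤ R) (hH : 0 ≤ H) (hΔ : 0 ≤ Δ) (hτ : 0 ≤ τ)
    (hτH : τ ≤ 2 * H) (hζ : 0 ≤ ζ) :
    Forces M K R H Δ τ ζ σ (rateConst * min (H ^ 2 * ζ ^ 2 / R) (Δ * τ / R)) := by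
  have hL := stepBound_pos
  have hR' : (1 : ℝ) ≤ R := by exact_mod_cast hR
  set v := min (H ^ 2 * ζ ^ 2) (Δ * τ)
  have hv : 0 ≤ v := by positivity
  have hvτ : v ≤ Δ * τ := min_le_right _ _
  have hΔv : Δ * (v / Δ) = v := mul_div_cancel_of_imp' fun h0 => by
    rw [h0, zero_mul] at hvτ
    exact le_antisymm hvτ hv
  obtain ⟨a, μ, ha, hμ, hgap, hsmooth, hsq⟩ := exists_scale (R + 1) hΔ (div_nonneg hv hΔ)
  have hF := scaledChain_parityWeight_inClass (M := M) (ζ := ζ) (by omega) ha hμ hgap hsmooth hsq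
    (div_le_of_le_mul₀ hΔ hτ (by linarith)) hτH (by positivity)
    (by rw [hΔv, mul_pow]; exact min_le_left _ _)
  refine (forces_of_progressBound hF (by norm_num) (third_le_mean_parityWeight hM)
    (progressBound_parity _ fun m c hc x hx => ?_)
    (fun r _ m => (parityProgress_le r m).trans r.isLt) (Nat.lt_succ_self R)).mono ?_
  · rw [gradient_scaledChain]
    exact Submodule.smul_mem _ _
      (chainGrad_mem_prefixSpace (if_neg hc) ((prefixSpace _ c).smul_mem μ hx))
  · calc rateConst * min (H ^ 2 * ζ ^ 2 / R) (Δ * τ / R) = v / (55296 * stepBound ^ 2 * R) := by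
          rw [rateConst, min_div_div_right (by positivity), div_mul_div_comm, one_mul]
      _ ≤ v / (18432 * stepBound ^ 2 * ((R + 1 : ℕ) + 1)) := by
          refine div_le_div_of_nonneg_left hv (by positivity) ?_
          push_cast
          nlinarith [sq_nonneg stepBound]
      _ = (a * μ) ^ 2 * (1 / 3 / 2) ^ 2 := by
          rw [hsq, hΔv]
          field_simp
          ring

/-! ### The stochastic instance -/

section Successes

open Finset

/-- The number of successes strictly before call `k` of round `r`. -/
def successesBefore (z : Fin R × Fin K × Fin M → Bool) (r : Fin R) (k : Fin K) : ℕ :=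
  #{i | z i = true ∧ toLex (i.1, i.2.1) < toLex (r, k)}

theorem successesBefore_add_toNat_le {z : Fin R × Fin K × Fin M → Bool} {r : Fin R} {k : Fin K}
    {m : Fin M} {s : Finset (Fin R × Fin K × Fin M)}
    (hs : ∀ i, z i = true → toLex (i.1, i.2.1) ≤ toLex (r, k) → i ∈ s) :
    successesBefore z r k + (z (r, k, m)).toNat ≤ #s := by
  set before : Finset (Fin R × Fin K × Fin M) :=
    {i | z i = true ∧ toLex (i.1, i.2.1) < toLex (r, k)}
  have hsub : before ⊆ s := fun i hi => by
    obtain ⟨hzi, hlt⟩ := (mem_filter.1 hi).2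
    exact hs i hzi hlt.le
  cases hz : z (r, k, m) with
  | false => exact card_le_card hsub
  | true =>
    have hmem : (r, k, m) ∉ before := fun hi => (mem_filter.1 hi).2.2.false
    calc #before + 1 = #(insert (r, k, m) before) := (card_insert_of_notMem hmem).symm
      _ ≤ #s := card_le_card (insert_subset (hs _ hz le_rfl) hsub)

theorem progressBound_masked {F : Vec T → ℝ} {B : Vec T → Vec T} {p : unitInterval}
    (hF : ∀ c, ∀ x ∈ prefixSpace T c, gradient F x ∈ prefixSpace T (c + 1))
    (hB : ∀ c, ∀ x ∈ prefixSpace T c, B x ∈ prefixSpace T (c + 1))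
    (hFB : ∀ c, ∀ x ∈ prefixSpace T c, gradient F x - B x ∈ prefixSpace T c)
    (z : Fin R × Fin K × Fin M → Bool) :
    ProgressBound (maskedOracle M F B p) z (fun r k _ => successesBefore z r k)
      (fun r k m => successesBefore z r k + (z (r, k, m)).toNat) where
  answer r k m x hx := by
    change gradient F x - mask p (z (r, k, m)) • B x ∈ _
    cases z (r, k, m) with
    | false => simpa [mask] using hFB _ x hx
    | true => exact sub_mem (hF _ x hx) (Submodule.smul_mem _ _ (hB _ x hx))
  round r' r k' k m' _ hr := successesBefore_add_toNat_le fun i hzi hi =>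
    mem_filter.2 ⟨mem_univ i, hzi, hi.trans_lt (Prod.Lex.toLex_lt_toLex.2 (.inl hr))⟩
  call r k' k m hk := successesBefore_add_toNat_le fun i hzi hi =>
    mem_filter.2 ⟨mem_univ i, hzi, hi.trans_lt (Prod.Lex.toLex_lt_toLex.2 (.inr ⟨rfl, hk⟩))⟩

/-- The part of the gradient of `scaledChain a μ 1` that discloses a new coordinate. -/
noncomputable def scaledHidden (a μ : ℝ) (x : Vec T) : Vec T := (a * μ) • hidden (μ • x)

theorem progressBound_scaledChain (a μ : ℝ) (p : unitInterval)
    (z : Fin R × Fin K × Fin M → Bool) :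
    ProgressBound (maskedOracle M (scaledChain a μ 1 : Vec T → ℝ) (scaledHidden a μ) p) z
      (fun r k _ => successesBefore z r k)
      (fun r k m => successesBefore z r k + (z (r, k, m)).toNat) := by
  have hscale {c : ℕ} {x : Vec T} (hx : x ∈ prefixSpace T c) : μ • x ∈ prefixSpace T c :=
    Submodule.smul_mem _ μ hx
  refine progressBound_masked (fun c x hx => ?_) (fun c x hx => ?_) (fun c x hx => ?_) z
  · rw [gradient_scaledChain]
    exact Submodule.smul_mem _ _ (chainGrad_mem_prefixSpace_succ 1 (hscale hx))
  · exact Submodule.smul_mem _ _ (hidden_mem_prefixSpace_succ (hscale hx))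
  · rw [gradient_scaledChain, scaledHidden, ← smul_sub]
    exact Submodule.smul_mem _ _ (chainGrad_sub_hidden_mem_prefixSpace (hscale hx))

theorem maskedOracle_scaledChain_isFor {p : unitInterval} (hp : 0 < (p : ℝ)) (ha : 0 ≤ a)
    (hμ : 0 ≤ μ) (hH : a * μ ^ 2 * (64 * stepBound ^ 2) ≤ H) (hσ : (a * μ) ^ 2 ≤ p * σ ^ 2) :
    (maskedOracle M (scaledChain a μ 1 : Vec T → ℝ) (scaledHidden a μ) p).IsFor
      (fun _ => scaledChain a μ 1) H σ := by
  have hL := one_le_stepBound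
  refine maskedOracle_isFor hp (differentiable_scaledChain a μ 1).continuous
    (norm_gradient_scaledChain_sub_le ha hμ (B := 1) fun k => by simp)
    (norm_smul_comp_smul_sub_le ha hμ norm_hidden_sub_le) ?_ fun x => ?_
  · calc a * μ ^ 2 * (32 * stepBound * 1) + 2 * (a * μ ^ 2 * (5 * stepBound))
        = a * μ ^ 2 * (42 * stepBound) := by ring
      _ ≤ a * μ ^ 2 * (64 * stepBound ^ 2) :=
          mul_le_mul_of_nonneg_left (by nlinarith) (by positivity)
      _ ≤ H := hH
  · rw [scaledHidden, norm_smul, mul_pow, Real.norm_eq_abs, sq_abs]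
    exact (mul_le_of_le_one_right (sq_nonneg _) (norm_sq_hidden_le_one _)).trans hσ

theorem forces_masked {p : unitInterval} (hM : 0 < M) (hT : 0 < T) (hp : 0 < (p : ℝ))
    (hpT : 2 * (R * (K * M) * (p : ℝ)) ≤ T) (ha : 0 ≤ a) (hμ : 0 ≤ μ)
    (hΔ : 8 * (T + 1) * a ≤ Δ) (hH : a * μ ^ 2 * (64 * stepBound ^ 2) ≤ H)
    (hσ : (a * μ) ^ 2 ≤ p * σ ^ 2) (hτ : 0 ≤ τ) (hζ : 0 ≤ ζ) :
    Forces M K R H Δ τ ζ σ ((a * μ) ^ 2 * (1 / 2) ^ 2 / 2) :=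
  ⟨T, _, _, scaledChain_one_inClass hM ha hμ hΔ hH hτ hζ,
    maskedOracle_scaledChain_isFor hp ha hμ hH hσ, fun A =>
      le_expectedError_maskedOracle A hT hpT fun z hz =>
        sq_le_norm_sq_gradient_avg_scaledChain zero_le_one (one_le_mean_one hM) hz
          ((progressBound_scaledChain a μ p z).output_mem A fun _ _ _ =>
            successesBefore_add_toNat_le fun _ hzi _ => mem_filter.2 ⟨mem_univ _, hzi⟩)⟩

end Successes

theorem forces_of_mul_le_sq_mul (hn : 0 < M * K * R) (hT : 0 < T) (hTn : T ≤ M * K * R)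
    (hH : 0 ≤ H) (hΔ : 0 ≤ Δ) (hτ : 0 ≤ τ) (hζ : 0 ≤ ζ)
    (hσ : (M * K * R : ℕ) * (Δ * H) ≤ (T * σ) ^ 2) :
    Forces M K R H Δ τ ζ σ (rateConst * (3 * (Δ * H) / (T + 1))) := by
  have hL := one_le_stepBound
  have hn' : (0 : ℝ) < (M * K * R : ℕ) := Nat.cast_pos.2 hn
  have hT' : (0 : ℝ) < T := Nat.cast_pos.2 hT
  have hTn' : (T : ℝ) ≤ (M * K * R : ℕ) := Nat.cast_le.2 hTn
  obtain ⟨a, μ, ha, hμ, hgap, hsmooth, hsq⟩ := exists_scale T hΔ hH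
  let p : unitInterval := ⟨T / (2 * (M * K * R : ℕ)), by positivity, by
    rw [div_le_one (by positivity)]
    linarith⟩
  have hp : (p : ℝ) = T / (2 * (M * K * R : ℕ)) := rfl
  have hpT : 2 * (R * (K * M) * (p : ℝ)) = T := by
    rw [show (R : ℝ) * (K * M) = (M * K * R : ℕ) by push_cast; ring, hp]
    field_simp
  have hvar : (a * μ) ^ 2 ≤ p * σ ^ 2 := by
    rw [hsq, hp, div_mul_eq_mul_div, div_le_div_iff₀ (by positivity) (by positivity)]
    calc Δ * H * (2 * (M * K * R : ℕ)) = 2 * ((M * K * R : ℕ) * (Δ * H)) := by ring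
      _ ≤ 2 * (T * σ) ^ 2 := by gcongr
      _ = T * σ ^ 2 * (2 * T) := by ring
      _ ≤ T * σ ^ 2 * (512 * stepBound ^ 2 * (T + 1)) := by
          gcongr
          · nlinarith
          · linarith
  have hM : 0 < M := Nat.pos_of_mul_pos_right (Nat.pos_of_mul_pos_right hn)
  have hp0 : 0 < (p : ℝ) := by
    rw [hp]
    positivity
  refine (forces_masked hM hT hp0 hpT.le ha hμ hgap hsmooth hvar hτ hζ).mono ?_
  calc rateConst * (3 * (Δ * H) / (T + 1)) = Δ * H / (18432 * stepBound ^ 2 * (T + 1)) := by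
        rw [rateConst]
        field_simp
        ring
    _ ≤ Δ * H / (4096 * stepBound ^ 2 * (T + 1)) := by
        gcongr
        norm_num
    _ = (a * μ) ^ 2 * (1 / 2) ^ 2 / 2 := by
        rw [hsq]
        field_simp
        ring

theorem exists_nat_mul_le_sq_mul {n : ℕ} {u : ℝ} (hn : 0 < n) (hσ : 0 < σ)
    (hup : σ ^ 2 / n ≤ u) (hlow : u ≤ n * σ ^ 2) :
    ∃ T : ℕ, 0 < T ∧ T ≤ n ∧ n * u ≤ (T * σ) ^ 2 ∧ σ * √(u / n) ≤ 3 * u / (T + 1) := by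
  have hn' : (0 : ℝ) < n := Nat.cast_pos.2 hn
  have hu : 0 < u := lt_of_lt_of_le (by positivity) hup
  set q := √(n * u) / σ with hq
  have hqσ : q * σ = √(n * u) := div_mul_cancel₀ _ hσ.ne'
  have hq1 : 1 ≤ q := by
    rw [hq, one_le_div hσ, Real.le_sqrt' hσ]
    rwa [div_le_iff₀' hn'] at hup
  have hqn : q ≤ n := by
    rw [hq, div_le_iff₀ hσ, Real.sqrt_le_left (by positivity)]
    nlinarith
  have hceil : (⌈q⌉₊ : ℝ) < q + 1 := Nat.ceil_lt_add_one (by linarith)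
  have hrate : σ * √(u / n) = u / q := by
    rw [hq, div_div_eq_mul_div, eq_div_iff (by positivity), mul_assoc,
      ← Real.sqrt_mul (by positivity),
      show u / n * (n * u) = u ^ 2 by field_simp, Real.sqrt_sq hu.le, mul_comm]
  refine ⟨⌈q⌉₊, Nat.ceil_pos.2 (by linarith), Nat.ceil_le.2 hqn, ?_, ?_⟩
  · calc (n : ℝ) * u = (q * σ) ^ 2 := by rw [hqσ, Real.sq_sqrt (by positivity)]
      _ ≤ (⌈q⌉₊ * σ) ^ 2 := by
          gcongr
          exact Nat.le_ceil q
  · rw [hrate, div_le_div_iff₀ (by positivity) (by positivity)]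
    nlinarith

theorem forces_of_large_noise (hn : 0 < M * K * R) (hH : 0 ≤ H) (hΔ : 0 ≤ Δ) (hτ : 0 ≤ τ)
    (hζ : 0 ≤ ζ) (hσ : 0 < σ) (hup : σ ^ 2 / (M * K * R : ℕ) ≤ Δ * H)
    (hlow : Δ * H ≤ (M * K * R : ℕ) * σ ^ 2) :
    Forces M K R H Δ τ ζ σ (rateConst * (σ * √(Δ * H / (M * K * R : ℕ)))) := by
  obtain ⟨T, hT, hTn, hTσ, hrate⟩ := exists_nat_mul_le_sq_mul hn hσ hup hlow
  exact (forces_of_mul_le_sq_mul hn hT hTn hH hΔ hτ hζ hTσ).mono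
    (mul_le_mul_of_nonneg_left hrate rateConst_pos.le)

/-! ### Combining the three instances -/

theorem rpow_two_thirds_le {x y : ℝ} (hx : 0 ≤ x) (hy : 0 ≤ y) (h : x ^ 2 ≤ y ^ 3) :
    x ^ ((2 : ℝ) / 3) ≤ y :=
  calc x ^ ((2 : ℝ) / 3) = (x ^ 2) ^ ((1 : ℝ) / 3) := by
        rw [← Real.rpow_natCast_mul hx]
        norm_num
    _ ≤ (y ^ 3) ^ ((1 : ℝ) / 3) := by gcongr
    _ = y := by
        rw [← Real.rpow_natCast_mul hy]
        norm_num

theorem stochastic_terms_le_of_small_noise {n u : ℝ} (hσ : 0 ≤ σ) (hu : 0 ≤ u) (hn : 1 ≤ n)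
    (h : n * σ ^ 2 ≤ u) : σ ^ 2 / n + (σ * u / n) ^ ((2 : ℝ) / 3) ≤ 2 * (u / n) := by
  have hσu : σ ^ 2 ≤ u := (le_mul_of_one_le_left (sq_nonneg σ) hn).trans h
  have hfirst : σ ^ 2 / n ≤ u / n := by gcongr
  have hsecond : (σ * u / n) ^ ((2 : ℝ) / 3) ≤ u / n := by
    refine rpow_two_thirds_le (by positivity) (by positivity) ?_
    calc (σ * u / n) ^ 2 = n * σ ^ 2 * u ^ 2 / n ^ 3 := by field_simp
      _ ≤ u * u ^ 2 / n ^ 3 := by gcongr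
      _ = (u / n) ^ 3 := by ring
  linarith

theorem stochastic_terms_le_of_large_noise {n u : ℝ} (hσ : 0 ≤ σ) (hu : 0 ≤ u) (hn : 0 < n)
    (hup : σ ^ 2 / n ≤ u) (hlow : u ≤ n * σ ^ 2) :
    σ ^ 2 / n + (σ * u / n) ^ ((2 : ℝ) / 3) ≤ 2 * (σ * √(u / n)) := by
  set s := √(u / n)
  have hs2 : s ^ 2 = u / n := Real.sq_sqrt (by positivity)
  have hsσ : s ≤ σ := (Real.sqrt_le_left hσ).2 ((div_le_iff₀' hn).2 hlow)
  have hσs : σ / n ≤ s := Real.le_sqrt_of_sq_le <|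
    calc (σ / n) ^ 2 = σ ^ 2 / n / n := by ring
      _ ≤ u / n := by gcongr
  have hfirst : σ ^ 2 / n ≤ σ * s := by
    rw [sq, mul_div_assoc]
    gcongr
  have hsecond : (σ * u / n) ^ ((2 : ℝ) / 3) ≤ σ * s := by
    refine rpow_two_thirds_le (by positivity) (by positivity) ?_
    calc (σ * u / n) ^ 2 = s * (σ ^ 2 * s ^ 3) := by rw [mul_div_assoc, ← hs2]; ring
      _ ≤ σ * (σ ^ 2 * s ^ 3) := by gcongr
      _ = (σ * s) ^ 3 := by ring
  linarith

theorem forces_stochastic (hM : 2 ≤ M) (hK : 1 ≤ K) (hR : 1 ≤ R) (hH : 0 ≤ H) (hΔ : 0 ≤ Δ)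
    (hτ : 0 ≤ τ) (hζ : 0 ≤ ζ) (hσ : 0 ≤ σ) (hup : σ ^ 2 / (M * K * R : ℕ) ≤ Δ * H) :
    Forces M K R H Δ τ ζ σ (rateConst * ((σ ^ 2 / (M * K * R : ℕ)
      + (σ * (Δ * H) / (M * K * R : ℕ)) ^ ((2 : ℝ) / 3)) / 2)) := by
  have hn : 0 < M * K * R := by positivity
  have hn1 : (1 : ℝ) ≤ (M * K * R : ℕ) := by exact_mod_cast hn
  have hΔH : 0 ≤ Δ * H := by positivity
  rcases le_or_gt ((M * K * R : ℕ) * σ ^ 2) (Δ * H) with hsmall | hlarge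
  · refine (forces_sequential (by omega) hK hR hH hΔ hτ hζ).mono
      (mul_le_mul_of_nonneg_left ?_ rateConst_pos.le)
    have hterms := stochastic_terms_le_of_small_noise hσ hΔH hn1 hsmall
    have hMKR : Δ * H / (M * K * R : ℕ) ≤ Δ * H / (K * R) := by
      gcongr
      exact_mod_cast mul_assoc M K R ▸ Nat.le_mul_of_pos_left (K * R) (by omega)
    linarith
  · have hσ0 : 0 < σ := hσ.lt_of_ne' fun h0 => by
      have hpos := hΔH.trans_lt hlarge
      simp [h0] at hpos
    refine (forces_of_large_noise hn hH hΔ hτ hζ hσ0 hup hlarge.le).mono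
      (mul_le_mul_of_nonneg_left ?_ rateConst_pos.le)
    linarith [stochastic_terms_le_of_large_noise hσ hΔH (by linarith) hup hlarge.le]

theorem forces_lower_bound (hM : 2 ≤ M) (hK : 1 ≤ K) (hR : 1 ≤ R) (hH : 0 ≤ H) (hΔ : 0 ≤ Δ)
    (hτ : 0 ≤ τ) (hτH : τ ≤ 2 * H) (hζ : 0 ≤ ζ) (hσ : 0 ≤ σ)
    (hup : σ ^ 2 / (M * K * R) ≤ Δ * H) :
    Forces M K R H Δ τ ζ σ (rateConst / 4 * (min (H ^ 2 * ζ ^ 2 / R) (Δ * τ / R)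
      + Δ * H / (K * R) + σ ^ 2 / (M * K * R)
      + (σ * Δ * H / (M * K * R)) ^ ((2 : ℝ) / 3))) := by
  have hn : ((M * K * R : ℕ) : ℝ) = M * K * R := by push_cast; rfl
  have hstoch := forces_stochastic hM hK hR hH hΔ hτ hζ hσ (by rwa [hn])
  rw [hn, ← mul_assoc σ] at hstoch
  refine (((forces_heterogeneous hM hR hH hΔ hτ hτH hζ).mean
    (forces_sequential (by omega) hK hR hH hΔ hτ hζ)).mean hstoch).mono (le_of_eq ?_)
  ring

end Instances

/-! ### Optimality of CE-LSGD -/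

theorem InClass.celsgdError_le_minimaxError {M K N d : ℕ} {H Δ τ ζ : ℝ} {F : Fin M → Vec d → ℝ}
    (hF : InClass F H Δ τ ζ) (hM : 2 ≤ M) (hK : 1 ≤ K) (hN : 2 ≤ N) (hH : 0 < H) (hΔ : 0 ≤ Δ)
    (hτ : 0 ≤ τ) (hτH : τ ≤ 2 * H) (hζ : 0 ≤ ζ) (hle : Δ * τ ≤ H ^ 2 * ζ ^ 2) :
    ENNReal.ofReal (celsgdError (1 / 2 / max H (K * τ)) K N F)
      ≤ ENNReal.ofReal (64 / rateConst) * minimaxError M K (2 * N) H Δ τ ζ 0 := by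
  have hc := rateConst_pos
  have hlow := (forces_lower_bound (R := 2 * N) (σ := 0) hM hK (by omega) hH.le hΔ hτ hτH hζ le_rfl
    (by rw [zero_pow two_ne_zero, zero_div]; positivity)).le_minimaxError
  refine le_trans ?_ (mul_le_mul_right hlow _)
  rw [← ENNReal.ofReal_mul (by positivity)]
  refine ENNReal.ofReal_le_ofReal
    ((hF.celsgdError_le (by omega) hH hΔ hτ hK hN).trans (le_of_eq ?_))
  rw [min_eq_right (div_le_div_of_nonneg_right hle (by positivity)), zero_mul, zero_mul, zero_div,
    Real.zero_rpow (by norm_num)]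
  push_cast
  field_simp
  ring

end DistOpt

theorem mainTheorem9 :
    (∃ c : ℝ, 0 < c ∧ ∀ (M K R : ℕ) (H Δ τ ζ σ : ℝ),
      2 ≤ M → 1 ≤ K → 1 ≤ R → 0 < H → 0 ≤ Δ → 0 ≤ τ → τ ≤ 2 * H → 0 ≤ ζ → 0 ≤ σ →
      σ ^ 2 / (M * K * R) ≤ Δ * H →
      ∃ (d : ℕ) (F : Fin M → DistOpt.Vec d → ℝ) (O : DistOpt.Oracle M d),
        DistOpt.InClass F H Δ τ ζ ∧ O.IsFor F H σ ∧
        ∀ A : DistOpt.ZRAlgorithm M K R d,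
          ENNReal.ofReal (c * (min (H ^ 2 * ζ ^ 2 / R) (Δ * τ / R) + Δ * H / (K * R)
            + σ ^ 2 / (M * K * R) + (σ * Δ * H / (M * K * R)) ^ ((2 : ℝ) / 3)))
          ≤ DistOpt.expectedError A F O) ∧
    (∃ a C : ℝ, 0 < a ∧ 0 < C ∧ ∀ (M K N : ℕ) (H Δ τ ζ : ℝ),
      2 ≤ M → 1 ≤ K → 2 ≤ N → 0 < H → 0 ≤ Δ → 0 ≤ τ → τ ≤ 2 * H → 0 ≤ ζ →
      Δ * τ ≤ H ^ 2 * ζ ^ 2 →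
      ∀ (d : ℕ) (F : Fin M → DistOpt.Vec d → ℝ), DistOpt.InClass F H Δ τ ζ →
        ENNReal.ofReal (DistOpt.celsgdError (a / max H (K * τ)) K N F)
          ≤ ENNReal.ofReal C * DistOpt.minimaxError M K (2 * N) H Δ τ ζ 0) := by
  refine ⟨⟨DistOpt.rateConst / 4, by linarith [DistOpt.rateConst_pos], ?_⟩,
    1 / 2, 64 / DistOpt.rateConst, by norm_num, div_pos (by norm_num) DistOpt.rateConst_pos, ?_⟩
  · intro M K R H Δ τ ζ σ hM hK hR hH hΔ hτ hτH hζ hσ hup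
    exact DistOpt.forces_lower_bound hM hK hR hH.le hΔ hτ hτH hζ hσ hup
  · intro M K N H Δ τ ζ hM hK hN hH hΔ hτ hτH hζ hle d F hF
    exact hF.celsgdError_le_minimaxError hM hK hN hH hΔ hτ hτH hζ hle
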